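/- Let $N\ge 2$ be an integer, let $q\in\mathbb C$ with $0<|q|<1$, and let $a_1,\dots,a_{2N}\in\mathbb C$ with $|a_j|<1$ and $$|q^{N-1}|<|a_1a_2\cdots a_{2N}| .$$ If $N$ is odd, assume moreover that $0<q<1$ and that no $a_j$ lies on the cut $(-\infty,0]$. Write $(x;q)_\infty=\prod_{k\ge0}(1-xq^k)$, $\theta(x;q)=(x;q)_\infty(qx^{-1};q)_\infty$, and $$\Phi(z)=\frac{z-z^{-1}}{z^{N/2}-z^{-N/2}}\;\frac{(z^{N};q^{N/2})_\infty(z^{-N};q^{N/2})_\infty}{\prod_{j=1}^{2N}(a_jz;q)_\infty(a_jz^{-1};q)_\infty},\qquad I_N=\int_C\Phi(z)\,\frac{dz}{2\pi\sqrt{-1}\,z},$$ with principal powers (cut along the negative real axis). For $N$ even, $C$ is the positively oriented unit circle. For $N$ odd, $C$ comes from $\infty e^{-\pi\sqrt{-1}}$ to $e^{-\pi\sqrt{-1}}$ along the lower edge of the cut, runs once anticlockwise around the unit circle to $e^{\pi\sqrt{-1}}$, and leaves to $\infty e^{\pi\sqrt{-1}}$ along the upper edge. Then: (i) $I_\varepsilon:=\int_{|z|=\varepsilon}\Phi(z)\frac{dz}{2\pi\sqrt{-1}z}\to0$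 as $\varepsilon\to0^+$ through radii with $\varepsilon\ne|a_kq^\nu|$ for all $k$ and all $\nu\ge0$; for odd $N$ the circle is taken from argument $-\pi$ to $\pi$. (ii) The integral defining $I_N$ converges absolutely, where for odd $N$ the contributions of the two edges of the cut are combined. (iii) If $a_j\ne a_kq^n$ for all $j\ne k$ and $n\in\mathbb Z$, then $$I_N=\sum_{k=1}^{2N}\sum_{\nu=0}^\infty\operatorname*{Res}_{z=a_kq^\nu}\Phi(z)\frac{dz}{z},$$ the double series being absolutely convergent. (iv) Suppose in addition that $a_ja_k\ne q^n$ for all $j,k$ (including $j=k$) and $n\in\mathbb Z$. Let $s_j$ be any numbers with $q^{s_j}=a_j$ (where $q^{c}=e^{c\log q}$ with the principal logarithm), and put $$P(z)=\frac{z^{N/2}\theta(z^{-N};q^{N/2})}{\prod_{j=1}^{2N}z^{1/2-s_j}\theta(a_jz^{-1};q)},\qquad Q(z)=(z^{-1}-z)\prod_{j=1}^{2N}z^{1/2-s_j}\frac{(qa_j^{-1}z;q)_\infty}{(a_jz;q)_\infty},$$ $$h(z)=z^{N-1-s_1-\cdots-s_{2N}}\frac{\theta(z^2;q)}{\prod_{j=1}^{2N}\theta(a_jz;q)},\qquad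 J_N(z)=\sum_{\nu=-\infty}^{\infty}Q(zq^\nu),\qquad \mathcal J_N(z)=\frac{J_N(z)}{h(z)},$$ where $(zq^\nu)^c$ means $e^{c(\log z+\nu\log q)}$ (the value of $\mathcal J_N(z)$ does not depend on the chosen $\log z$). Then the series $J_N(a_k)$ converge absolutely and $$I_N=\sum_{k=1}^{2N}R_k\,\mathcal J_N(a_k),$$ where, with $a_k^{c}$ defined by the principal logarithm of $a_k$, $$R_k=\Big(\operatorname*{Res}_{z=a_k}P(z)\frac{dz}{z}\Big)h(a_k)=\frac{a_k^{N/2-1}\,\theta(a_k^{-N};q^{N/2})}{(q;q)_\infty^2\prod_{j\ne k}\theta(a_ja_k;q)\,\theta(a_j/a_k;q)} .$$ -/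

import Mathlib

open Complex Filter Topology MeasureTheory

noncomputable section

namespace SemiClassical

/-- The infinite `q`-shifted factorial `(x; q)_∞ = ∏_{k ≥ 0} (1 - x q^k)` (used for `|q| < 1`). -/
def qPoch (x q : ℂ) : ℂ := ∏' k : ℕ, (1 - x * q ^ k)

/-- The theta function `θ(x; q) = (x; q)_∞ (q x⁻¹; q)_∞`. -/
def theta (x q : ℂ) : ℂ := qPoch x q * qPoch (q * x⁻¹) q

/-- The residue of `f` at a point `p` where `f` is regular or has an isolated singularity:
`(2πi)⁻¹ ∮_{|z - p| = r} f(z) dz` for all sufficiently small `r > 0`. -/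
def residue (f : ℂ → ℂ) (p : ℂ) : ℂ :=
  limUnder (𝓝[>] (0 : ℝ)) (fun r : ℝ => (2 * (Real.pi : ℂ) * I)⁻¹ * ∮ z in C(p, r), f z)

section

variable (N : ℕ) (q : ℂ) (a : Fin (2 * N) → ℂ)

/-- The integrand
`Φ(z) = (z - z⁻¹) / (z^{N/2} - z^{-N/2}) * (z^N, z^{-N}; q^{N/2})_∞ / ∏_j (a_j z, a_j z⁻¹; q)_∞`
at the point `z = e^u` of the Riemann surface of the logarithm, where `z^{N/2}` means `e^{N u / 2}`.
For even `N` this depends only on `e^u`. -/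
def PhiLog (u : ℂ) : ℂ :=
  (exp u - exp (-u)) / (exp ((N : ℂ) / 2 * u) - exp (-((N : ℂ) / 2 * u)))
    * (qPoch (exp (N * u)) (q ^ ((N : ℂ) / 2)) * qPoch (exp (-(N * u))) (q ^ ((N : ℂ) / 2)))
    / ∏ j, (qPoch (a j * exp u) q * qPoch (a j * exp (-u)) q)

/-- The integrand `Φ(z)` with the principal branch of `z^{N/2}` (cut along the negative axis). -/
def Phi (z : ℂ) : ℂ := PhiLog N q a (log z)

/-- The contribution to `∫ Φ(z) dz/z` of the two edges of the cut outside the unit circle, at `-x`,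
`x > 1`: the contour comes in from `∞ e^{-πi}` below the cut and leaves to `∞ e^{πi}` above it.
It vanishes identically for even `N`. -/
def tailIntegrand (x : ℝ) : ℂ :=
  (PhiLog N q a ((Real.log x : ℂ) + Real.pi * I)
    - PhiLog N q a ((Real.log x : ℂ) - Real.pi * I)) / (x : ℂ)

/-- The integral `I_N(a_1, …, a_{2N}) = ∫ Φ(z) dz / (2πi z)` over the unit circle together with the
tail along the cut. -/
def IN : ℂ :=
  (2 * (Real.pi : ℂ) * I)⁻¹ *
    ((∮ z in C(0, 1), Phi N q a z / z) + ∫ x in Set.Ioi (1 : ℝ), tailIntegrand N q a x)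

/-- The integral `I_ε = ∫_{|z| = ε} Φ(z) dz / (2πi z)`. -/
def IEps (ε : ℝ) : ℂ :=
  (2 * (Real.pi : ℂ) * I)⁻¹ * ∮ z in C(0, ε), Phi N q a z / z

/-- The coefficient
`R_k = a_k^{N/2-1} θ(a_k^{-N}; q^{N/2}) / ((q;q)_∞² ∏_{j ≠ k} θ(a_j a_k; q) θ(a_j / a_k; q))`. -/
def R (k : Fin (2 * N)) : ℂ :=
  a k ^ ((N : ℂ) / 2 - 1) * theta ((a k ^ N)⁻¹) (q ^ ((N : ℂ) / 2))
    / (qPoch q q ^ 2 * ∏ j ∈ Finset.univ.erase k, (theta (a j * a k) q * theta (a j / a k) q))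

variable (s : Fin (2 * N) → ℂ)

/-- `P(z) = z^{N/2} θ(z^{-N}; q^{N/2}) / ∏_j z^{1/2 - s_j} θ(a_j z⁻¹; q)` at `z = e^u`, where
`z^c` means `e^{c u}`; here `q^{s_j} = a_j`. -/
def PLog (u : ℂ) : ℂ :=
  exp ((N : ℂ) / 2 * u) * theta (exp (-(N * u))) (q ^ ((N : ℂ) / 2))
    / ∏ j, (exp ((1 / 2 - s j) * u) * theta (a j * exp (-u)) q)

/-- `Q(z) = (z⁻¹ - z) ∏_j z^{1/2 - s_j} (q a_j⁻¹ z; q)_∞ / (a_j z; q)_∞` at `z = e^u`, where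
`z^c` means `e^{c u}`. -/
def QLog (u : ℂ) : ℂ :=
  (exp (-u) - exp u) *
    ∏ j, (exp ((1 / 2 - s j) * u) * (qPoch (q * (a j)⁻¹ * exp u) q / qPoch (a j * exp u) q))

/-- The Jackson integral `J_N(z) = ∑_{ν ∈ ℤ} Q(z q^ν)` at `z = e^u`; the point `z q^ν` is taken
at the logarithm `u + ν log q`. -/
def JLog (u : ℂ) : ℂ := ∑' ν : ℤ, QLog N q a s (u + ν * log q)

/-- `h(z) = z^{N - 1 - s_1 - ⋯ - s_{2N}} θ(z²; q) / ∏_j θ(a_j z; q)` at `z = e^u`. -/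
def hLog (u : ℂ) : ℂ :=
  exp (((N : ℂ) - 1 - ∑ j, s j) * u) * theta (exp u ^ 2) q / ∏ j, theta (a j * exp u) q

/-- The regularised Jackson integral `𝒥_N(z) = J_N(z) / h(z)`. When `u` changes by `2πi`, both
`J_N` and `h` are multiplied by `e^{-2πi (s_1 + ⋯ + s_{2N})}`, so the quotient does not depend on
the logarithm of `z`; the principal one is used. -/
def regJ (z : ℂ) : ℂ := JLog N q a s (log z) / hLog N q a s (log z)

end

end SemiClassical

end

namespace SemiClassical

/-! In the coordinate `u = log z` the integrand factors as Φ = P·Q (`PhiLog_eq_PLog_mul_QLog`). The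
theta quotient P is invariant under `z ↦ qz` (`PLog_add_log`). Each such shift multiplies Q by
`q^(N-1)/∏ a_j`, up to factors that stay bounded (`QLog_add_nat_mul_log`). The norm condition makes
this ratio smaller than one in modulus, so Φ decays like a positive power of `|z|` at the origin,
away from its poles.

The residue theorem is applied on the rectangle `[t, 0] × [-π, π]` in `u`
(`integral_rect_eq_sum_residues`). Its right side is the unit circle and its left side is the circle
of radius `e^t`. Its horizontal sides are the two edges of the cut inside the unit disc. Since `Φ(z)
= Φ(1/z)`, these inner edges carry the same integral as the tail outside the disc (`edge_neg`). As
`t → -∞` along circles missing the poles, the left side vanishes (`exists_verticalIntegral_decay`),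
so `I_N` is the sum of the residues (`hasSum_residues`).

By the periodicity of P, the residue at `a_k q^n` is a constant depending only on `k` times `Q(a_k
q^n)`. As Q vanishes at `a_k q^n` for `n < 0` (`QLog_eq_zero_of_neg`), summing over `n` yields the
bilateral Jackson integral. Multiplying and dividing by `h(a_k)` gives `R_k` times the regularised
one (`R_eq`, `IN_eq_sum`). -/

/-! ### The infinite q-shifted factorial and the theta function. -/

lemma multipliable_qPoch {q : ℂ} (hq : ‖q‖ < 1) (x : ℂ) :
    Multipliable fun k : ℕ => (1 - x * q ^ k) := by
  have : Summable fun k : ℕ => ‖-(x * q ^ k)‖ := by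
    simp only [norm_neg, norm_mul, norm_pow]
    exact (summable_geometric_of_lt_one (norm_nonneg _) hq).mul_left _
  simpa [sub_eq_add_neg] using multipliable_one_add_of_summable this

lemma differentiable_qPoch {q : ℂ} (hq : ‖q‖ < 1) : Differentiable ℂ fun x => qPoch x q := by
  intro x
  have hmem : x ∈ Metric.ball (0 : ℂ) (‖x‖ + 1) := by simp
  have h := (Summable.hasProdLocallyUniformlyOn_nat_one_add
    (f := fun (k : ℕ) (y : ℂ) => -(y * q ^ k)) (K := Metric.ball (0 : ℂ) (‖x‖ + 1))
    Metric.isOpen_ball (u := fun k => (‖x‖ + 1) * ‖q‖ ^ k)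
    ((summable_geometric_of_lt_one (norm_nonneg _) hq).mul_left _)
    (Eventually.of_forall fun n y hy => by
      rw [norm_neg, norm_mul, norm_pow]
      gcongr
      simpa using (mem_ball_zero_iff.1 hy).le) (fun n => by fun_prop)).differentiableOn
    (.of_forall fun _ => by
      simpa [Finset.prod_fn] using DifferentiableOn.finsetProd (fun _ _ => by fun_prop))
    Metric.isOpen_ball
  have h2 := h.differentiableAt (Metric.isOpen_ball.mem_nhds hmem)
  simpa [qPoch, sub_eq_add_neg] using h2

lemma differentiable_qPoch_comp {q : ℂ} (hq : ‖q‖ < 1) {f : ℂ → ℂ} (hf : Differentiable ℂ f) :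
    Differentiable ℂ fun x => qPoch (f x) q :=
  (differentiable_qPoch hq).comp hf

lemma continuous_qPoch {q : ℂ} (hq : ‖q‖ < 1) : Continuous fun x => qPoch x q :=
  (differentiable_qPoch hq).continuous

lemma qPoch_succ {q : ℂ} (hq : ‖q‖ < 1) (x : ℂ) : qPoch x q = (1 - x) * qPoch (x * q) q := by
  have h := multipliable_qPoch hq (x * q)
  have : (∏' k : ℕ, (1 - x * q ^ k)) = (1 - x * q ^ 0) * ∏' k : ℕ, (1 - x * q ^ (k + 1)) := by
    apply tprod_eq_zero_mul' (f := fun k : ℕ => 1 - x * q ^ k)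
    simpa [pow_succ', mul_assoc] using h
  rw [qPoch, this, qPoch]
  simp [pow_succ', mul_assoc]

lemma qPoch_eq_zero_iff {q : ℂ} (hq : ‖q‖ < 1) (x : ℂ) :
    qPoch x q = 0 ↔ ∃ k : ℕ, x * q ^ k = 1 := by
  constructor
  · intro h
    by_contra! hne
    refine tprod_one_add_ne_zero_of_summable (f := fun k : ℕ => -(x * q ^ k)) (fun k hk => ?_) ?_ ?_
    · exact hne k (by linear_combination -hk)
    · simp only [norm_neg, norm_mul, norm_pow]
      exact (summable_geometric_of_lt_one (norm_nonneg _) hq).mul_left _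
    · simpa [qPoch, sub_eq_add_neg] using h
  · rintro ⟨k, hk⟩
    exact tprod_of_exists_eq_zero ⟨k, by simp [hk]⟩

lemma qPoch_ne_zero_of_norm_lt {q : ℂ} (hq : ‖q‖ < 1) {x : ℂ} (hx : ‖x‖ < 1) : qPoch x q ≠ 0 := by
  intro h
  obtain ⟨k, hk⟩ := (qPoch_eq_zero_iff hq x).1 h
  have : ‖x * q ^ k‖ < 1 := by
    rw [norm_mul, norm_pow]
    exact mul_lt_one_of_nonneg_of_lt_one_left (norm_nonneg _) hx
      (pow_le_one₀ (norm_nonneg _) hq.le)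
  simp [hk] at this

/-- The first factor contributes the powers with exponent `n ≤ 0`, the second those with `n ≥ 1`. -/
lemma theta_eq_zero_iff {q : ℂ} (hq0 : q ≠ 0) (hq : ‖q‖ < 1) {x : ℂ} (hx : x ≠ 0) :
    theta x q = 0 ↔ ∃ n : ℤ, x = q ^ n := by
  rw [theta, mul_eq_zero, qPoch_eq_zero_iff hq, qPoch_eq_zero_iff hq]
  constructor
  · rintro (⟨k, hk⟩ | ⟨k, hk⟩)
    · exact ⟨-k, by rw [zpow_neg, zpow_natCast]; exact eq_inv_of_mul_eq_one_left hk⟩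
    · refine ⟨k + 1, ?_⟩
      rw [zpow_add_one₀ hq0, zpow_natCast]
      field_simp at hk
      linear_combination -hk
  · rintro ⟨n, rfl⟩
    rcases le_or_gt n 0 with hn | hn
    · obtain ⟨k, rfl⟩ := Int.exists_eq_neg_ofNat hn
      exact Or.inl ⟨k, by simp [hq0]⟩
    · obtain ⟨k, rfl⟩ := Int.eq_succ_of_zero_lt hn
      refine Or.inr ⟨k, ?_⟩
      rw [zpow_add_one₀ hq0, zpow_natCast]
      field_simp

/-- Moving one linear factor from one product to the other gives the quasi-periodicity behind the
invariance of P. -/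
lemma theta_div {q : ℂ} (hq0 : q ≠ 0) (hq : ‖q‖ < 1) {x : ℂ} (hx : x ≠ 0) :
    theta (x / q) q = -(x / q) * theta x q := by
  have h1 := qPoch_succ hq (x / q)
  have h2 := qPoch_succ hq (q * x⁻¹)
  have h3 : q * (x / q)⁻¹ = q * x⁻¹ * q := by field_simp
  have h4 : x / q * q = x := by field_simp
  rw [theta, theta, h1, h2, h3, h4]
  field_simp
  ring

/-! ### Simple poles and the residue theorem in the logarithmic coordinate. -/

/-- The singularity of `(z - p) f z` is removable, so Cauchy's formula gives the same value on every
small circle and the limit defining the residue is eventually constant. -/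
lemma residue_eq_of_tendsto {f : ℂ → ℂ} {p c : ℂ}
    (hd : ∀ᶠ z in 𝓝[≠] p, DifferentiableAt ℂ f z)
    (hc : Tendsto (fun z => (z - p) * f z) (𝓝[≠] p) (𝓝 c)) : residue f p = c := by
  set g : ℂ → ℂ := Function.update (fun z => (z - p) * f z) p c with hg
  have hgne : ∀ z, z ≠ p → g z = (z - p) * f z := fun z hz => by simp [hg, hz]
  have hga : AnalyticAt ℂ g p := by
    apply analyticAt_of_differentiable_on_punctured_nhds_of_continuousAt
    · filter_upwards [hd, self_mem_nhdsWithin] with z hz hzp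
      have : g =ᶠ[𝓝 z] fun z => (z - p) * f z := by
        filter_upwards [isOpen_ne.mem_nhds hzp] with w hw using hgne w hw
      rw [this.differentiableAt_iff]
      fun_prop
    · rwa [hg, continuousAt_update_same]
  obtain ⟨r, hr, hball⟩ := Metric.eventually_nhds_iff_ball.1 hga.eventually_analyticAt
  have key : ∀ᶠ ρ in 𝓝[>] (0 : ℝ), (2 * (Real.pi : ℂ) * I)⁻¹ * (∮ z in C(p, ρ), f z) = c := by
    filter_upwards [Ioo_mem_nhdsGT hr] with ρ hρ
    have hd' : DifferentiableOn ℂ g (Metric.closedBall p ρ) := fun z hz =>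
      (hball z (lt_of_le_of_lt (Metric.mem_closedBall.1 hz) hρ.2)).differentiableAt.differentiableWithinAt
    have h1 := (hd'.diffContOnCl_ball subset_rfl).two_pi_i_inv_smul_circleIntegral_sub_inv_smul
      (Metric.mem_ball_self hρ.1)
    have h2 : (∮ z in C(p, ρ), f z) = ∮ z in C(p, ρ), (z - p)⁻¹ • g z := by
      apply circleIntegral.integral_congr hρ.1.le
      intro z hz
      have hzp : z ≠ p := by
        rintro rfl
        have := mem_sphere_iff_norm.1 hz
        simp at this
        exact hρ.1.ne this
      have : z - p ≠ 0 := sub_ne_zero.2 hzp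
      simp only [hgne z hzp, smul_eq_mul]
      field_simp
    rw [h2, ← smul_eq_mul, h1]
    simp [hg]
  exact ((tendsto_congr' key).2 tendsto_const_nhds).limUnder_eq

/-- Removable singularities, phrased with the punctured limit so that the default value of `G` at
`c` plays no role. -/
lemma differentiableAt_limUnder {G : ℂ → ℂ} {c : ℂ}
    (hd : ∀ᶠ z in 𝓝[≠] c, DifferentiableAt ℂ G z)
    (h0 : Tendsto (fun z => (z - c) * G z) (𝓝[≠] c) (𝓝 0)) :
    DifferentiableAt ℂ (fun u => limUnder (𝓝[≠] u) G) c := by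
  have hd' := eventually_nhdsWithin_iff.1 hd
  have hdo : DifferentiableOn ℂ G ({z | z ≠ c → DifferentiableAt ℂ G z} \ {c}) := fun z hz =>
    (hz.1 hz.2).differentiableWithinAt
  have ho : (fun z => G z - G c) =o[𝓝[≠] c] fun z => (z - c)⁻¹ := by
    rw [Asymptotics.isLittleO_iff_tendsto']
    · have h1 : Tendsto (fun z => (z - c) * G c) (𝓝[≠] c) (𝓝 0) := by
        have : Tendsto (fun z => (z - c) * G c) (𝓝 c) (𝓝 ((c - c) * G c)) :=
          Continuous.tendsto (by fun_prop) c
        simpa using this.mono_left nhdsWithin_le_nhds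
      have h2 := h0.sub h1
      simp only [sub_zero] at h2
      refine h2.congr fun z => ?_
      simp [div_eq_mul_inv]; ring
    · filter_upwards [self_mem_nhdsWithin] with z hz h
      exact absurd (inv_eq_zero.1 h) (sub_ne_zero.2 hz)
  have H := (differentiableOn_update_limUnder_of_isLittleO hd' hdo ho).differentiableAt hd'
  refine H.congr_of_eventuallyEq ?_
  filter_upwards [hd'] with z hz
  rcases eq_or_ne z c with rfl | hne
  · simp
  · simp only [Function.update_of_ne hne]
    exact ((hz hne).continuousAt.tendsto.mono_left nhdsWithin_le_nhds).limUnder_eq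

/-- The angle is moved to `[-π, π]`, the range on which the principal logarithm inverts `exp`. -/
lemma circleIntegral_eq_integral_exp (f : ℂ → ℂ) (t : ℝ) :
    (∮ z in C(0, Real.exp t), f z) =
      I * ∫ θ in (-Real.pi)..Real.pi, exp (t + θ * I) * f (exp (t + θ * I)) := by
  have hper : Function.Periodic
      (fun θ : ℝ => deriv (circleMap 0 (Real.exp t)) θ • f (circleMap 0 (Real.exp t) θ))
      (2 * Real.pi) := fun θ => by
    simp only [deriv_circleMap, periodic_circleMap 0 (Real.exp t) θ]
  have h := hper.intervalIntegral_add_eq 0 (-Real.pi)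
  rw [zero_add, show -Real.pi + 2 * Real.pi = Real.pi by ring] at h
  rw [circleIntegral, h, ← intervalIntegral.integral_const_mul]
  congr 1
  ext θ
  have : circleMap 0 (Real.exp t) θ = exp (t + θ * I) := by simp [circleMap, exp_add]
  rw [deriv_circleMap, this, smul_eq_mul]
  ring

lemma integral_exp_div_sub_of_lt {p : ℂ} {t : ℝ} (h : ‖p‖ < Real.exp t) :
    ∫ θ in (-Real.pi)..Real.pi, exp (t + θ * I) / (exp (t + θ * I) - p) = 2 * Real.pi := by
  have h1 := circleIntegral_eq_integral_exp (fun z => (z - p)⁻¹) t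
  rw [circleIntegral.integral_sub_inv_of_mem_ball (by simpa using h)] at h1
  simp only [div_eq_mul_inv]
  apply mul_left_cancel₀ I_ne_zero
  rw [← h1]; ring

lemma integral_exp_div_sub_of_gt {p : ℂ} {t : ℝ} (h : Real.exp t < ‖p‖) :
    ∫ θ in (-Real.pi)..Real.pi, exp (t + θ * I) / (exp (t + θ * I) - p) = 0 := by
  have h1 := circleIntegral_eq_integral_exp (fun z => (z - p)⁻¹) t
  have hne : ∀ z ∈ Metric.closedBall (0 : ℂ) (Real.exp t), z - p ≠ 0 := by
    intro z hz hzp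
    rw [sub_eq_zero.1 hzp] at hz
    simp only [mem_closedBall_zero_iff] at hz
    linarith
  have h2 : (∮ z in C(0, Real.exp t), (z - p)⁻¹) = 0 := by
    apply DiffContOnCl.circleIntegral_eq_zero (Real.exp_pos t).le
    apply DifferentiableOn.diffContOnCl_ball (U := Metric.closedBall 0 (Real.exp t)) _ subset_rfl
    intro z hz
    exact ((differentiableAt_id.sub_const p).inv (hne z hz)).differentiableWithinAt
  rw [h2] at h1
  simp only [div_eq_mul_inv]
  exact (mul_eq_zero.1 h1.symm).resolve_left I_ne_zero

lemma tendsto_sub_mul_exp_div {u p : ℂ} (h : exp u = p) :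
    Tendsto (fun w => (w - u) * (exp w / (exp w - p))) (𝓝[≠] u) (𝓝 1) := by
  have h1 := (hasDerivAt_iff_tendsto_slope.1 (Complex.hasDerivAt_exp u)).inv₀ (exp_ne_zero u)
  have h2 : Tendsto exp (𝓝[≠] u) (𝓝 (exp u)) :=
    (Complex.continuous_exp.tendsto u).mono_left nhdsWithin_le_nhds
  have h3 := h1.mul h2
  rw [inv_mul_cancel₀ (exp_ne_zero u)] at h3
  refine h3.congr fun w => ?_
  rw [slope_def_field, inv_div, h]
  ring

lemma tendsto_sub_mul_of_continuousAt {g : ℂ → ℂ} {u : ℂ} (h : ContinuousAt g u) :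
    Tendsto (fun w => (w - u) * g w) (𝓝[≠] u) (𝓝 0) := by
  have : ContinuousAt (fun w => (w - u) * g w) u := by fun_prop
  have h1 := this.tendsto
  simp only [sub_self, zero_mul] at h1
  exact h1.mono_left nhdsWithin_le_nhds

lemma continuous_exp_div_sub {p : ℂ} {t : ℝ} (h : ‖p‖ ≠ Real.exp t) :
    Continuous fun θ : ℝ => exp (t + θ * I) / (exp (t + θ * I) - p) := by
  refine Continuous.div (by fun_prop) (by fun_prop) fun θ hθ => h ?_
  rw [← sub_eq_zero.1 hθ, norm_exp]
  simp

lemma mem_rect_iff {t₁ t₂ : ℝ} (h : t₁ < t₂) {u : ℂ} :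
    u ∈ (Set.uIcc t₁ t₂ ×ℂ Set.uIcc (-Real.pi) Real.pi) ↔
      u.re ∈ Set.Icc t₁ t₂ ∧ u.im ∈ Set.Icc (-Real.pi) Real.pi := by
  rw [mem_reProdIm, Set.uIcc_of_le h.le, Set.uIcc_of_le (by linarith [Real.pi_pos])]

/-- The residue theorem on `[t₁, t₂] × [-π, π]` for a function whose singularities are simple poles
at logarithms of the points `p i`. -/
theorem integral_rect_eq_sum_residues {ι : Type*} (T : Finset ι) (p r : ι → ℂ)
    (hinj : Set.InjOn p T) (f : ℂ → ℂ) {t₁ t₂ : ℝ} (h12 : t₁ < t₂)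
    (hp : ∀ i ∈ T, Real.exp t₁ < ‖p i‖ ∧ ‖p i‖ < Real.exp t₂)
    (hreg : ∀ u : ℂ, u.re ∈ Set.Icc t₁ t₂ → u.im ∈ Set.Icc (-Real.pi) Real.pi →
      (∀ i ∈ T, exp u ≠ p i) → DifferentiableAt ℂ f u)
    (hd : ∀ u : ℂ, ∀ᶠ w in 𝓝[≠] u, DifferentiableAt ℂ f w)
    (hlim : ∀ u : ℂ, u.re ∈ Set.Icc t₁ t₂ → u.im ∈ Set.Icc (-Real.pi) Real.pi →
      ∀ i ∈ T, exp u = p i → Tendsto (fun w => (w - u) * f w) (𝓝[≠] u) (𝓝 (r i))) :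
    I * (∫ θ in (-Real.pi)..Real.pi, f (t₂ + θ * I))
      - I * (∫ θ in (-Real.pi)..Real.pi, f (t₁ + θ * I))
      - (∫ x in t₁..t₂, (f (x + Real.pi * I) - f (x - Real.pi * I)))
      = 2 * Real.pi * I * ∑ i ∈ T, r i := by
  classical
  -- This kernel has residue one at every logarithm of `p i` and period `2πi`. Subtracting its
  -- multiples therefore also removes poles lying on the horizontal sides, without affecting the
  -- difference of those sides.
  set k : ι → ℂ → ℂ := fun i w => exp w / (exp w - p i) with hk
  set G : ℂ → ℂ := fun w => f w - ∑ i ∈ T, r i * k i w with hG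
  set Gt : ℂ → ℂ := fun u => limUnder (𝓝[≠] u) G with hGt
  have hkd : ∀ i w, exp w ≠ p i → DifferentiableAt ℂ (k i) w := fun i w hw =>
    (Complex.differentiableAt_exp).div (Complex.differentiableAt_exp.sub_const _) (sub_ne_zero.2 hw)
  have hGd : ∀ u : ℂ, DifferentiableAt ℂ f u → (∀ i ∈ T, exp u ≠ p i) → DifferentiableAt ℂ G u := by
    intro u hu hne
    refine hu.sub ?_
    exact DifferentiableAt.fun_sum fun i hi => (hkd i u (hne i hi)).const_mul _
  have hGd' : ∀ u, ∀ᶠ w in 𝓝[≠] u, DifferentiableAt ℂ G w := by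
    intro u
    have : ∀ᶠ w in 𝓝[≠] u, ∀ i ∈ T, exp w ≠ p i :=
      (Finset.eventually_all T).2 fun i _ =>
        (Complex.hasDerivAt_exp u).eventually_ne (exp_ne_zero u)
    filter_upwards [this, hd u] with w h1 h2 using hGd w h2 h1
  have hGteq : ∀ u : ℂ, u.re ∈ Set.Icc t₁ t₂ → u.im ∈ Set.Icc (-Real.pi) Real.pi →
      (∀ i ∈ T, exp u ≠ p i) → Gt u = G u := fun u h1 h2 h3 =>
    ((hGd u (hreg u h1 h2 h3) h3).continuousAt.tendsto.mono_left nhdsWithin_le_nhds).limUnder_eq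
  have hGtd : ∀ u : ℂ, u.re ∈ Set.Icc t₁ t₂ → u.im ∈ Set.Icc (-Real.pi) Real.pi →
      DifferentiableAt ℂ Gt u := by
    intro u h1 h2
    refine differentiableAt_limUnder (hGd' u) ?_
    by_cases hne : ∀ i ∈ T, exp u ≠ p i
    · exact tendsto_sub_mul_of_continuousAt (hGd u (hreg u h1 h2 hne) hne).continuousAt
    · push Not at hne
      obtain ⟨i, hi, hui⟩ := hne
      have ha := hlim u h1 h2 i hi hui
      have hb : Tendsto (fun w => ∑ j ∈ T, r j * ((w - u) * k j w)) (𝓝[≠] u)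
          (𝓝 (∑ j ∈ T, r j * if j = i then 1 else 0)) := by
        refine tendsto_finsetSum _ fun j hj => Tendsto.const_mul _ ?_
        split_ifs with hji
        · exact tendsto_sub_mul_exp_div (hji ▸ hui)
        · refine tendsto_sub_mul_of_continuousAt (hkd j u fun h => hji ?_).continuousAt
          exact hinj hj hi (h.symm.trans hui)
      have hc := ha.sub hb
      have : r i - (∑ j ∈ T, r j * if j = i then 1 else 0) = 0 := by simp [hi]
      rw [this] at hc
      refine hc.congr fun w => ?_
      rw [hG]
      simp only [mul_sub, Finset.mul_sum]
      congr 1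
      exact Finset.sum_congr rfl fun j _ => by ring
  have hπ := Real.pi_pos
  have hrect := Complex.integral_boundary_rect_eq_zero_of_differentiableOn Gt
    (t₁ - Real.pi * I) (t₂ + Real.pi * I) (fun u hu => by
      have hu' := (mem_rect_iff h12 (u := u)).1 (by simpa using hu)
      exact (hGtd u hu'.1 hu'.2).differentiableWithinAt)
  simp only [sub_re, ofReal_re, mul_re, I_re, mul_zero, ofReal_im, I_im, mul_one, sub_self, sub_zero,
    add_re, add_zero, sub_im, mul_im, zero_sub, add_im, zero_add, ofReal_neg, smul_eq_mul] at hrect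
  -- vertical sides
  have hside : ∀ t : ℝ, t ∈ Set.Icc t₁ t₂ → (∀ i ∈ T, ‖p i‖ ≠ Real.exp t) →
      (∫ θ in (-Real.pi)..Real.pi, Gt (t + θ * I)) =
        (∫ θ in (-Real.pi)..Real.pi, f (t + θ * I))
          - ∑ i ∈ T, r i * ∫ θ in (-Real.pi)..Real.pi, k i (t + θ * I) := by
    intro t ht hne
    have hne' : ∀ θ : ℝ, ∀ i ∈ T, exp (t + θ * I) ≠ p i := by
      intro θ i hi h
      apply hne i hi
      rw [← h, norm_exp]; simp
    have hkc : ∀ i ∈ T, Continuous fun θ : ℝ => k i (t + θ * I) := fun i hi =>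
      continuous_exp_div_sub (hne i hi)
    have hfc : ContinuousOn (fun θ : ℝ => f (t + θ * I)) (Set.uIcc (-Real.pi) Real.pi) := by
      intro θ hθ
      rw [Set.uIcc_of_le (by linarith)] at hθ
      have := (hreg (t + θ * I) (by simpa using ht) (by simpa using hθ) (hne' θ)).continuousAt
      exact (ContinuousAt.comp (f := fun θ : ℝ => (t : ℂ) + θ * I) this
        (by fun_prop)).continuousWithinAt
    have : (∫ θ in (-Real.pi)..Real.pi, Gt (t + θ * I)) = ∫ θ in (-Real.pi)..Real.pi,
        (f (t + θ * I) - ∑ i ∈ T, r i * k i (t + θ * I)) := by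
      apply intervalIntegral.integral_congr
      intro θ hθ
      rw [Set.uIcc_of_le (by linarith)] at hθ
      exact hGteq _ (by simpa using ht) (by simpa using hθ) (hne' θ)
    rw [this, intervalIntegral.integral_sub hfc.intervalIntegrable,
      intervalIntegral.integral_finsetSum]
    · simp only [intervalIntegral.integral_const_mul]
    · exact fun i hi => (continuous_const.mul (hkc i hi)).intervalIntegrable _ _
    · exact (continuous_finsetSum _ fun i hi =>
        continuous_const.mul (hkc i hi)).intervalIntegrable _ _
  have hs2 := hside t₂ ⟨h12.le, le_rfl⟩ fun i hi => (hp i hi).2.ne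
  have hs1 := hside t₁ ⟨le_rfl, h12.le⟩ fun i hi => (hp i hi).1.ne'
  have hk2 : ∑ i ∈ T, r i * ∫ θ in (-Real.pi)..Real.pi, k i (t₂ + θ * I) =
      2 * Real.pi * ∑ i ∈ T, r i := by
    rw [Finset.mul_sum]
    exact Finset.sum_congr rfl fun i hi => by
      rw [integral_exp_div_sub_of_lt (hp i hi).2]; ring
  have hk1 : ∑ i ∈ T, r i * ∫ θ in (-Real.pi)..Real.pi, k i (t₁ + θ * I) = 0 :=
    Finset.sum_eq_zero fun i hi => by rw [integral_exp_div_sub_of_gt (hp i hi).1, mul_zero]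
  rw [hk2] at hs2
  rw [hk1, sub_zero] at hs1
  -- horizontal sides
  have hcont : ∀ y : ℝ, y ∈ Set.Icc (-Real.pi) Real.pi →
      IntervalIntegrable (fun x : ℝ => Gt (x + y * I)) volume t₁ t₂ := by
    intro y hy
    refine ContinuousOn.intervalIntegrable fun x hx => ?_
    rw [Set.uIcc_of_le h12.le] at hx
    exact (ContinuousAt.comp (f := fun x : ℝ => (x : ℂ) + y * I)
      (hGtd (x + y * I) (by simpa using hx) (by simpa using hy)).continuousAt
      (by fun_prop)).continuousWithinAt
  have hhor : (∫ x in t₁..t₂, (f (x + Real.pi * I) - f (x - Real.pi * I))) =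
      (∫ x in t₁..t₂, Gt (x + Real.pi * I)) - ∫ x in t₁..t₂, Gt (x + -Real.pi * I) := by
    rw [← intervalIntegral.integral_sub (hcont Real.pi ⟨by linarith, le_rfl⟩)
      (by simpa using hcont (-Real.pi) ⟨le_rfl, by linarith⟩)]
    -- Poles may lie on the horizontal sides, but only above the finitely many abscissae `log ‖p
    -- i‖`, which form a null set.
    apply intervalIntegral.integral_congr_ae
    have hfin : (T.image fun i => Real.log ‖p i‖ : Set ℝ).Countable := Finset.countable_toSet _
    filter_upwards [compl_mem_ae_iff.2 (hfin.measure_zero volume)] with x hx hx'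
    rw [Set.uIoc_of_le h12.le] at hx'
    have hne : ∀ y : ℝ, ∀ i ∈ T, exp (x + y * I) ≠ p i := by
      intro y i hi h
      apply hx
      simp only [Finset.coe_image, Set.mem_image, Finset.mem_coe]
      refine ⟨i, hi, ?_⟩
      rw [← h, norm_exp]; simp
    have e1 := hGteq (x + Real.pi * I) (by simpa using ⟨hx'.1.le, hx'.2⟩)
      (by simp; linarith) (hne _)
    have e2 := hGteq (x + -Real.pi * I) (by simpa using ⟨hx'.1.le, hx'.2⟩)
      (by simp; linarith) (by simpa using hne (-Real.pi))
    -- The kernels agree on the two sides and cancel.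
    have e3 : exp (x + -Real.pi * I) = exp (x + Real.pi * I) := by
      rw [← exp_periodic (x + -Real.pi * I)]
      congr 1; ring
    rw [e1, e2, hG]
    simp only [hk, e3]
    rw [show (x : ℂ) + -Real.pi * I = x - Real.pi * I by ring]
    ring
  rw [hhor]
  rw [hs1, hs2] at hrect
  linear_combination hrect

/-! ### Symmetries of Φ, its factorisation, and its decay under q-shifts. -/

section
variable {N : ℕ} {q : ℂ} {a : Fin (2 * N) → ℂ} {s : Fin (2 * N) → ℂ}

lemma norm_cpow_half_lt_one (hN : 0 < N) (hq0 : q ≠ 0) (hq : ‖q‖ < 1) :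
    ‖q ^ ((N : ℂ) / 2)‖ < 1 := by
  rw [cpow_def_of_ne_zero hq0, norm_exp, Real.exp_lt_one_iff]
  have h1 : (log q * ((N : ℂ) / 2)).re = Real.log ‖q‖ * (N / 2) := by
    rw [show ((N : ℂ) / 2) = (((N : ℝ) / 2 : ℝ) : ℂ) by push_cast; rfl, re_mul_ofReal, log_re]
  rw [h1]
  exact mul_neg_of_neg_of_pos (Real.log_neg (norm_pos_iff.2 hq0) hq) (by positivity)

lemma cpow_half_ne_zero (hq0 : q ≠ 0) : q ^ ((N : ℂ) / 2) ≠ 0 := by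
  rw [cpow_def_of_ne_zero hq0]; exact exp_ne_zero _

variable (q a) in
/-- The denominator `∏_j (a_j z, a_j z⁻¹; q)_∞` of `Φ` at `z = e^u`. -/
noncomputable def PhiDen (u : ℂ) : ℂ := ∏ j, (qPoch (a j * exp u) q * qPoch (a j * exp (-u)) q)

/-- Since `(1 - z^N)(1 - z^(-N)) = -(z^(N/2) - z^(-N/2))²`, the denominator `z^(N/2) - z^(-N/2)`
cancels and only the zeros of `PhiDen` can be singular. -/
lemma PhiLog_eq (hN : 0 < N) (hq0 : q ≠ 0) (hq : ‖q‖ < 1) (u : ℂ) :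
    PhiLog N q a u = -((exp u - exp (-u)) * (exp ((N : ℂ) / 2 * u) - exp (-((N : ℂ) / 2 * u)))) *
      (qPoch (exp (N * u) * q ^ ((N : ℂ) / 2)) (q ^ ((N : ℂ) / 2)) *
        qPoch (exp (-(N * u)) * q ^ ((N : ℂ) / 2)) (q ^ ((N : ℂ) / 2))) / PhiDen q a u := by
  have hp := norm_cpow_half_lt_one hN hq0 hq
  have h1 : exp (N * u) = exp ((N : ℂ) / 2 * u) ^ 2 := by rw [← exp_nat_mul]; congr 1; push_cast; ring
  have h2 : exp (-(N * u)) = exp (-((N : ℂ) / 2 * u)) ^ 2 := by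
    rw [← exp_nat_mul]; congr 1; push_cast; ring
  have h3 : exp ((N : ℂ) / 2 * u) * exp (-((N : ℂ) / 2 * u)) = 1 := by rw [← exp_add]; simp
  rw [PhiLog, PhiDen, qPoch_succ hp (exp (N * u)), qPoch_succ hp (exp (-(N * u)))]
  congr 1
  generalize qPoch (exp (N * u) * q ^ ((N : ℂ) / 2)) (q ^ ((N : ℂ) / 2)) = A
  generalize qPoch (exp (-(N * u)) * q ^ ((N : ℂ) / 2)) (q ^ ((N : ℂ) / 2)) = B
  rw [h1, h2]
  generalize exp ((N : ℂ) / 2 * u) = E at *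
  generalize exp (-((N : ℂ) / 2 * u)) = E' at *
  -- Division by zero returns zero, which agrees with the cancelled form: that too carries the
  -- factor `E - E'`.
  by_cases hD : E - E' = 0
  · simp [hD]
  · field_simp
    linear_combination (exp u - exp (-u)) * A * B * (E * E' - 1) * h3

lemma differentiable_PhiDen (hq : ‖q‖ < 1) : Differentiable ℂ (PhiDen q a) := by
  unfold PhiDen
  refine Differentiable.fun_finsetProd fun j _ => ?_
  exact (differentiable_qPoch_comp hq (by fun_prop)).mul (differentiable_qPoch_comp hq (by fun_prop))

lemma differentiableAt_PhiLog (hN : 0 < N) (hq0 : q ≠ 0) (hq : ‖q‖ < 1) {u : ℂ}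
    (hu : PhiDen q a u ≠ 0) : DifferentiableAt ℂ (PhiLog N q a) u := by
  have hp := norm_cpow_half_lt_one hN hq0 hq
  rw [show PhiLog N q a = _ from funext (PhiLog_eq hN hq0 hq)]
  refine DifferentiableAt.div ?_ (differentiable_PhiDen hq u) hu
  refine DifferentiableAt.mul (by fun_prop) (DifferentiableAt.mul ?_ ?_)
  · exact (differentiable_qPoch_comp hp (by fun_prop)) u
  · exact (differentiable_qPoch_comp hp (by fun_prop)) u

/-- In the closed unit disc the factors in `a_j z` cannot vanish because `|a_j| < 1`; only those in
`a_j / z` can. -/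
lemma PhiDen_ne_zero (hq : ‖q‖ < 1) (ha1 : ∀ j, ‖a j‖ < 1) {u : ℂ} (hu : u.re ≤ 0)
    (h : ∀ j (n : ℕ), exp u ≠ a j * q ^ n) : PhiDen q a u ≠ 0 := by
  rw [PhiDen, Finset.prod_ne_zero_iff]
  intro j _
  refine mul_ne_zero (qPoch_ne_zero_of_norm_lt hq ?_) fun h0 => ?_
  · rw [norm_mul, norm_exp]
    exact mul_lt_one_of_nonneg_of_lt_one_left (norm_nonneg _) (ha1 j) (Real.exp_le_one_iff.2 hu)
  · obtain ⟨k, hk⟩ := (qPoch_eq_zero_iff hq _).1 h0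
    apply h j k
    have := exp_ne_zero u
    rw [exp_neg] at hk
    field_simp at hk
    exact hk.symm

lemma eventually_ne_zero_of_differentiable {f : ℂ → ℂ} (hf : Differentiable ℂ f) {w₀ : ℂ}
    (h0 : f w₀ ≠ 0) (u : ℂ) : ∀ᶠ w in 𝓝[≠] u, f w ≠ 0 := by
  by_contra h
  have han : AnalyticOnNhd ℂ f Set.univ := hf.differentiableOn.analyticOnNhd isOpen_univ
  exact h0 (han.eqOn_zero_of_preconnected_of_frequently_eq_zero isPreconnected_univ
    (Set.mem_univ u) ((Filter.not_eventually.1 h).mono fun _ => not_not.1) (Set.mem_univ w₀))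

lemma eventually_PhiDen_ne_zero (hq : ‖q‖ < 1) (ha1 : ∀ j, ‖a j‖ < 1) (u : ℂ) :
    ∀ᶠ w in 𝓝[≠] u, PhiDen q a w ≠ 0 := by
  refine eventually_ne_zero_of_differentiable (differentiable_PhiDen hq) (w₀ := 0) ?_ u
  rw [PhiDen, Finset.prod_ne_zero_iff]
  intro j _
  simp [qPoch_ne_zero_of_norm_lt hq (ha1 j)]

lemma PhiLog_neg (u : ℂ) : PhiLog N q a (-u) = PhiLog N q a u := by
  have h : PhiDen q a (-u) = PhiDen q a u := by
    simp only [PhiDen, neg_neg]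
    exact Finset.prod_congr rfl fun j _ => mul_comm _ _
  unfold PhiDen at h
  unfold PhiLog
  rw [h]
  simp only [mul_neg, neg_neg]
  rw [← neg_sub (exp u), ← neg_sub (exp ((N : ℂ) / 2 * u)), neg_div_neg_eq,
    mul_comm (qPoch (exp (-(N * u))) _)]

lemma PhiLog_add_two_pi (u : ℂ) :
    PhiLog N q a (u + 2 * Real.pi * I) = (-1) ^ N * PhiLog N q a u := by
  have e1 : exp (u + 2 * Real.pi * I) = exp u := exp_periodic u
  have e2 : exp (-(u + 2 * Real.pi * I)) = exp (-u) := by rw [exp_neg, e1, exp_neg]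
  have e3 : exp ((N : ℂ) / 2 * (u + 2 * Real.pi * I)) = (-1) ^ N * exp ((N : ℂ) / 2 * u) := by
    rw [← exp_pi_mul_I, ← exp_nat_mul, ← exp_add]; congr 1; ring
  have e4 : exp (-((N : ℂ) / 2 * (u + 2 * Real.pi * I))) =
      (-1) ^ N * exp (-((N : ℂ) / 2 * u)) := by
    rw [exp_neg, e3, exp_neg, mul_inv]
    congr 1
    rcases neg_one_pow_eq_or ℂ N with h | h <;> rw [h] <;> norm_num
  have e5 : exp (N * (u + 2 * Real.pi * I)) = exp (N * u) := by
    rw [mul_add, exp_add, exp_nat_mul_two_pi_mul_I, mul_one]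
  have e6 : exp (-(N * (u + 2 * Real.pi * I))) = exp (-(N * u)) := by rw [exp_neg, e5, exp_neg]
  unfold PhiLog
  rw [e1, e2, e3, e4, e5, e6]
  rcases neg_one_pow_eq_or ℂ N with h | h <;> rw [h]
  · simp
  · rw [← mul_sub, neg_one_mul, div_neg]; ring

lemma norm_PhiLog_add_int (u : ℂ) (n : ℤ) :
    ‖PhiLog N q a (u + n * (2 * Real.pi * I))‖ = ‖PhiLog N q a u‖ := by
  have hper : Function.Periodic (fun u => ‖PhiLog N q a u‖) (2 * Real.pi * I) := fun u => by
    simp [PhiLog_add_two_pi]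
  exact hper.int_mul n u

lemma PhiLog_add_int_of_even (hN : Even N) (u : ℂ) (n : ℤ) :
    PhiLog N q a (u + n * (2 * Real.pi * I)) = PhiLog N q a u := by
  have hper : Function.Periodic (PhiLog N q a) (2 * Real.pi * I) := fun u => by
    simp [PhiLog_add_two_pi, hN.neg_one_pow]
  exact hper.int_mul n u

/-- The second half of `θ(a_j / z)` in P is the numerator factor of Q, and the powers `z^(1/2 -
s_j)` cancel. The hypothesis `h` permits this cancellation. -/
lemma PhiLog_eq_PLog_mul_QLog (hN : 0 < N) (hq0 : q ≠ 0) (hq : ‖q‖ < 1) (s : Fin (2 * N) → ℂ)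
    (u : ℂ) (h : ∀ j, qPoch (q * (a j)⁻¹ * exp u) q ≠ 0) :
    PhiLog N q a u = PLog N q a s u * QLog N q a s u := by
  have hp := norm_cpow_half_lt_one hN hq0 hq
  have h1 : (exp (-(N * u)))⁻¹ = exp (N * u) := by rw [← exp_neg, neg_neg]
  have h2 : exp (-(N * u)) = exp (-((N : ℂ) / 2 * u)) ^ 2 := by
    rw [← exp_nat_mul]; congr 1; push_cast; ring
  have h3 : exp ((N : ℂ) / 2 * u) * exp (-((N : ℂ) / 2 * u)) = 1 := by rw [← exp_add]; simp
  have h4 : (∏ j, (exp ((1 / 2 - s j) * u) * theta (a j * exp (-u)) q))⁻¹ *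
      ∏ j, (exp ((1 / 2 - s j) * u) * (qPoch (q * (a j)⁻¹ * exp u) q / qPoch (a j * exp u) q))
      = (PhiDen q a u)⁻¹ := by
    rw [PhiDen, ← Finset.prod_inv_distrib, ← Finset.prod_inv_distrib, ← Finset.prod_mul_distrib]
    refine Finset.prod_congr rfl fun j _ => ?_
    have e : q * (a j * exp (-u))⁻¹ = q * (a j)⁻¹ * exp u := by
      rw [mul_inv, ← exp_neg, neg_neg]; ring
    have h5 := h j
    have h6 := exp_ne_zero ((1 / 2 - s j) * u)
    rw [theta, e]
    generalize qPoch (q * (a j)⁻¹ * exp u) q = X at *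
    field_simp
  rw [PhiLog_eq hN hq0 hq, PLog, QLog, theta, h1, qPoch_succ hp (exp (-(N * u))),
    mul_comm (q ^ ((N : ℂ) / 2)) (exp (N * u)), div_eq_mul_inv _ (PhiDen q a u), ← h4]
  generalize qPoch (exp (N * u) * q ^ ((N : ℂ) / 2)) (q ^ ((N : ℂ) / 2)) = A
  generalize qPoch (exp (-(N * u)) * q ^ ((N : ℂ) / 2)) (q ^ ((N : ℂ) / 2)) = B
  generalize ∏ j, (exp ((1 / 2 - s j) * u) * theta (a j * exp (-u)) q) = X
  generalize ∏ j, (exp ((1 / 2 - s j) * u) *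
    (qPoch (q * (a j)⁻¹ * exp u) q / qPoch (a j * exp u) q)) = Y
  rw [h2]
  generalize exp ((N : ℂ) / 2 * u) = E at *
  generalize exp (-((N : ℂ) / 2 * u)) = E' at *
  linear_combination (exp (-u) - exp u) * A * B * X⁻¹ * Y * E' * h3

lemma exp_mul_log (hq0 : q ≠ 0) (hs : ∀ j, q ^ s j = a j) (j : Fin (2 * N)) :
    exp (s j * log q) = a j := by
  rw [← hs j, cpow_def_of_ne_zero hq0, mul_comm]

/-- The shift divides `z^(-N)` by `q^N`, two quasi-periods of the numerator theta of base `q^(N/2)`,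
and moves each of the `2N` denominator thetas by one. The multipliers match because `q^(s_j) = a_j`.
-/
lemma PLog_add_log (hN : 0 < N) (hq0 : q ≠ 0) (hq : ‖q‖ < 1) (hs : ∀ j, q ^ s j = a j) (u : ℂ) :
    PLog N q a s (u + log q) = PLog N q a s u := by
  have hp := norm_cpow_half_lt_one hN hq0 hq
  have hp0 : q ^ ((N : ℂ) / 2) ≠ 0 := cpow_half_ne_zero hq0
  have hpq : exp ((N : ℂ) / 2 * log q) = q ^ ((N : ℂ) / 2) := by
    rw [cpow_def_of_ne_zero hq0, mul_comm]
  have ha0 : ∀ j, a j ≠ 0 := fun j => by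
    rw [← exp_mul_log hq0 hs j]; exact exp_ne_zero _
  have h1 : exp (-(N * (u + log q))) =
      exp (-(N * u)) / q ^ ((N : ℂ) / 2) / q ^ ((N : ℂ) / 2) := by
    rw [← hpq, ← exp_sub, ← exp_sub]; congr 1; ring
  have h2 : ∀ j, exp ((1 / 2 - s j) * (u + log q)) * theta (a j * exp (-(u + log q))) q =
      -(exp (-(1 / 2 * log q)) * exp (-u)) *
        (exp ((1 / 2 - s j) * u) * theta (a j * exp (-u)) q) := by
    intro j
    have e1 : a j * exp (-(u + log q)) = a j * exp (-u) / q := by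
      rw [neg_add, exp_add, exp_neg (log q), exp_log hq0]; field_simp
    have e2 : exp ((1 / 2 - s j) * (u + log q)) =
        exp ((1 / 2 - s j) * u) * (exp (-(1 / 2 * log q)) * q * (a j)⁻¹) := by
      rw [← exp_mul_log hq0 hs j, ← exp_neg (s j * log q)]
      nth_rw 3 [← exp_log hq0]
      rw [← exp_add, ← exp_add, ← exp_add]
      congr 1; ring
    rw [e1, e2, theta_div hq0 hq (mul_ne_zero (ha0 j) (exp_ne_zero _))]
    have := ha0 j
    field_simp
  have h3 : (-(exp (-(1 / 2 * log q)) * exp (-u))) ^ (2 * N) =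
      (exp (-(N * u)) / q ^ ((N : ℂ) / 2)) ^ 2 := by
    rw [← hpq, ← exp_sub, pow_mul, neg_sq, ← pow_mul, ← exp_add, ← exp_nat_mul, ← exp_nat_mul]
    congr 1; push_cast; ring
  rw [PLog, PLog, h1, Finset.prod_congr rfl fun j _ => h2 j, Finset.prod_mul_distrib,
    Finset.prod_const, Finset.card_univ, Fintype.card_fin, h3, mul_add, exp_add, hpq,
    theta_div hp0 hp (div_ne_zero (exp_ne_zero _) hp0), theta_div hp0 hp (exp_ne_zero _)]
  have := exp_ne_zero (-(N * u))
  generalize ∏ j, (exp ((1 / 2 - s j) * u) * theta (a j * exp (-u)) q) = X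
  by_cases hX : X = 0
  · simp [hX]
  · field_simp

lemma PLog_add_nat_mul_log (hN : 0 < N) (hq0 : q ≠ 0) (hq : ‖q‖ < 1) (hs : ∀ j, q ^ s j = a j)
    (u : ℂ) (m : ℕ) : PLog N q a s (u + m * log q) = PLog N q a s u :=
  Function.Periodic.nat_mul (PLog_add_log hN hq0 hq hs) m u

/-- The `2N` powers `z^(1/2 - s_j)` contribute `q^N / ∏ a_j` per shift, and the leading `z⁻¹`
removes one factor `q`. -/
lemma QLog_add_nat_mul_log (hq0 : q ≠ 0) (hN : 0 < N) (hs : ∀ j, q ^ s j = a j) (u : ℂ) (m : ℕ) :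
    QLog N q a s (u + m * log q) = (q ^ (N - 1) / ∏ j, a j) ^ m *
      ((exp (-u) - exp u * q ^ (2 * m)) * ∏ j, (exp ((1 / 2 - s j) * u) *
        (qPoch (q * (a j)⁻¹ * (exp u * q ^ m)) q / qPoch (a j * (exp u * q ^ m)) q))) := by
  have e0 : exp (m * log q) = q ^ m := by rw [exp_nat_mul, exp_log hq0]
  have e1 : exp (u + m * log q) = exp u * q ^ m := by rw [exp_add, e0]
  have e2 : exp (-(u + m * log q)) = exp (-u) / q ^ m := by rw [neg_add, exp_add, exp_neg (m * _), e0]; rfl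
  have e3 : ∀ j, exp ((1 / 2 - s j) * (u + m * log q)) =
      (exp (1 / 2 * log q) / a j) ^ m * exp ((1 / 2 - s j) * u) := by
    intro j
    rw [← exp_mul_log hq0 hs j, ← exp_sub, ← exp_nat_mul, ← exp_add]
    congr 1; ring
  have e4 : ∏ j, (exp (1 / 2 * log q) / a j) ^ m = (q ^ N / ∏ j, a j) ^ m := by
    rw [Finset.prod_pow, Finset.prod_div_distrib, Finset.prod_const, Finset.card_univ,
      Fintype.card_fin, ← exp_nat_mul]
    congr 2
    rw [← exp_log hq0, ← exp_nat_mul, exp_log hq0]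
    congr 1; push_cast; ring
  have e5 : q ^ N = q ^ (N - 1) * q := by
    rw [← pow_succ, Nat.sub_add_cancel hN]
  rw [QLog, e1, e2]
  simp only [e3, mul_assoc ((_ : ℂ) ^ m)]
  rw [Finset.prod_mul_distrib, e4, e5, mul_div_right_comm, mul_pow]
  have := pow_ne_zero m hq0
  have e6 : q ^ (2 * m) = q ^ m * q ^ m := by rw [two_mul, pow_add]
  rw [e6]
  have key : ∀ V W : ℂ, (exp (-u) / q ^ m - exp u * q ^ m) * (W * q ^ m * V) =
      W * ((exp (-u) - exp u * (q ^ m * q ^ m)) * V) := fun V W => by field_simp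
  exact key _ _

lemma ne_zero_of_cond (hcond : ‖q ^ (N - 1)‖ < ‖∏ j, a j‖) (j : Fin (2 * N)) :
    a j ≠ 0 := by
  intro h
  rw [Finset.prod_eq_zero (Finset.mem_univ j) h, norm_zero] at hcond
  exact absurd hcond (norm_nonneg _).not_gt

/-- Once the geometric factor is extracted, everything else is evaluated at points `z q^m` of the
closed unit disc, where compactness gives bounds independent of `m`. -/
lemma exists_QLog_bound (hq0 : q ≠ 0) (hq : ‖q‖ < 1) (hN : 0 < N) (ha1 : ∀ j, ‖a j‖ < 1)
    (hs : ∀ j, q ^ s j = a j) {K : Set ℂ} (hK : IsCompact K) (hre : ∀ u ∈ K, u.re ≤ 0) :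
    ∃ C, 0 ≤ C ∧ ∀ u ∈ K, ∀ m : ℕ,
      ‖QLog N q a s (u + m * log q)‖ ≤ C * ‖q ^ (N - 1) / ∏ j, a j‖ ^ m := by
  obtain ⟨C1, hC1⟩ := hK.exists_bound_of_continuousOn (f := fun u => exp (-u)) (by fun_prop)
  have hnum : ∀ j, ∃ C, ∀ u ∈ K, ∀ m : ℕ, ‖exp ((1 / 2 - s j) * u) *
        (qPoch (q * (a j)⁻¹ * (exp u * q ^ m)) q / qPoch (a j * (exp u * q ^ m)) q)‖ ≤ C := by
    intro j
    obtain ⟨A, hA⟩ := hK.exists_bound_of_continuousOn (f := fun u => exp ((1 / 2 - s j) * u))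
      (by fun_prop)
    obtain ⟨B, hB⟩ := (isCompact_closedBall (0 : ℂ) ‖q * (a j)⁻¹‖).exists_bound_of_continuousOn
      (continuous_qPoch hq).continuousOn
    obtain ⟨D, hD⟩ := (isCompact_closedBall (0 : ℂ) ‖a j‖).exists_bound_of_continuousOn
      (f := fun x => (qPoch x q)⁻¹) ((continuous_qPoch hq).continuousOn.inv₀ fun x hx =>
        qPoch_ne_zero_of_norm_lt hq (lt_of_le_of_lt (by simpa using hx) (ha1 j)))
    refine ⟨A * (B * D), fun u hu m => ?_⟩
    have hz : ‖exp u * q ^ m‖ ≤ 1 := by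
      rw [norm_mul, norm_exp, norm_pow]
      exact mul_le_one₀ (Real.exp_le_one_iff.2 (hre u hu)) (by positivity)
        (pow_le_one₀ (norm_nonneg _) hq.le)
    have hb := hB (q * (a j)⁻¹ * (exp u * q ^ m)) (by
      rw [mem_closedBall_zero_iff, norm_mul]; exact mul_le_of_le_one_right (norm_nonneg _) hz)
    have hd := hD (a j * (exp u * q ^ m)) (by
      rw [mem_closedBall_zero_iff, norm_mul]; exact mul_le_of_le_one_right (norm_nonneg _) hz)
    rw [norm_mul, div_eq_mul_inv (qPoch _ _), norm_mul]
    have := hA u hu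
    have h0 := (norm_nonneg _).trans this
    have h1 := (norm_nonneg _).trans hb
    gcongr
  choose D hD using hnum
  -- The summand `1` bounds `e^u q^(2m)`; absolute values make the constant nonnegative even for
  -- empty `K`.
  refine ⟨|C1 + 1| * ∏ j, |D j|, by positivity, fun u hu m => ?_⟩
  rw [QLog_add_nat_mul_log hq0 hN hs, norm_mul, norm_pow, mul_comm, norm_mul, norm_prod]
  have h1 : ‖exp (-u) - exp u * q ^ (2 * m)‖ ≤ |C1 + 1| := by
    refine (norm_sub_le _ _).trans (le_trans (add_le_add (hC1 u hu) ?_) (le_abs_self _))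
    rw [norm_mul, norm_exp, norm_pow]
    exact mul_le_one₀ (Real.exp_le_one_iff.2 (hre u hu)) (by positivity)
        (pow_le_one₀ (norm_nonneg _) hq.le)
  have h2 := Finset.prod_le_prod (s := Finset.univ) (fun j _ => norm_nonneg _)
    fun j _ => (hD j u hu m).trans (le_abs_self _)
  gcongr

lemma differentiable_theta_exp_neg {p : ℂ} (hp : ‖p‖ < 1) (c d : ℂ) :
    Differentiable ℂ fun u => theta (c * exp (-(d * u))) p := by
  unfold theta
  have e : ∀ u, (c * exp (-(d * u)))⁻¹ = c⁻¹ * exp (d * u) := fun u => by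
    rw [mul_inv, ← exp_neg, neg_neg]
  simp only [e]
  exact (differentiable_qPoch_comp hp (by fun_prop)).mul
    (differentiable_qPoch_comp hp (by fun_prop))

lemma differentiableAt_PLog (hN : 0 < N) (hq0 : q ≠ 0) (hq : ‖q‖ < 1) {u : ℂ}
    (h : ∀ j, theta (a j * exp (-u)) q ≠ 0) : DifferentiableAt ℂ (PLog N q a s) u := by
  have hp := norm_cpow_half_lt_one hN hq0 hq
  unfold PLog
  refine DifferentiableAt.div (DifferentiableAt.mul (by fun_prop) ?_) ?_ ?_
  · simpa using differentiable_theta_exp_neg hp 1 N u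
  · refine DifferentiableAt.fun_finsetProd fun j _ => DifferentiableAt.mul (by fun_prop) ?_
    simpa using differentiable_theta_exp_neg hq (a j) 1 u
  · exact Finset.prod_ne_zero_iff.2 fun j _ => mul_ne_zero (exp_ne_zero _) (h j)

lemma theta_mul_exp_neg_ne_zero (hq0 : q ≠ 0) (hq : ‖q‖ < 1) {c u : ℂ} (hc : c ≠ 0)
    (h : ∀ n : ℤ, exp u ≠ c * q ^ n) : theta (c * exp (-u)) q ≠ 0 := by
  rw [Ne, theta_eq_zero_iff hq0 hq (mul_ne_zero hc (exp_ne_zero _))]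
  rintro ⟨n, hn⟩
  apply h (-n)
  rw [zpow_neg, ← hn, exp_neg]
  have := exp_ne_zero u
  field_simp

lemma qPoch_shift_ne_zero (hq0 : q ≠ 0) (hq : ‖q‖ < 1) {c u : ℂ} (hc : c ≠ 0) (m : ℕ)
    (h : ∀ n : ℤ, exp u ≠ c * q ^ n) : qPoch (q * c⁻¹ * exp (u + m * log q)) q ≠ 0 := by
  rw [Ne, qPoch_eq_zero_iff hq]
  rintro ⟨k, hk⟩
  apply h (-(1 + m + k : ℕ))
  rw [exp_add, exp_nat_mul, exp_log hq0] at hk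
  rw [zpow_neg, zpow_natCast, pow_add, pow_add, pow_one]
  field_simp at hk ⊢
  linear_combination hk

/-- `Φ` decays geometrically under `z ↦ q z`, uniformly on compact sets away from its poles. -/
lemma exists_PhiLog_bound (hq0 : q ≠ 0) (hq : ‖q‖ < 1) (hN : 0 < N) (ha1 : ∀ j, ‖a j‖ < 1)
    (ha0 : ∀ j, a j ≠ 0) {K : Set ℂ} (hK : IsCompact K) (hre : ∀ u ∈ K, u.re ≤ 0)
    (hne : ∀ u ∈ K, ∀ j (n : ℤ), exp u ≠ a j * q ^ n) :
    ∃ C, 0 ≤ C ∧ ∀ u ∈ K, ∀ m : ℕ,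
      ‖PhiLog N q a (u + m * log q)‖ ≤ C * ‖q ^ (N - 1) / ∏ j, a j‖ ^ m := by
  have hlog : log q ≠ 0 := fun h => by
    have := exp_log hq0
    rw [h, exp_zero] at this
    simp [← this] at hq
  -- Φ does not involve the exponents, so any admissible choice may be used for the factorisation.
  have hs : ∀ j, q ^ (log (a j) / log q) = a j := fun j => by
    rw [cpow_def_of_ne_zero hq0, mul_div_cancel₀ _ hlog, exp_log (ha0 j)]
  obtain ⟨C, hC0, hC⟩ := exists_QLog_bound hq0 hq hN ha1 hs hK hre
  obtain ⟨D, hD⟩ := hK.exists_bound_of_continuousOn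
    (f := PLog N q a fun j => log (a j) / log q) fun u hu =>
      (differentiableAt_PLog hN hq0 hq fun j =>
        theta_mul_exp_neg_ne_zero hq0 hq (ha0 j) (hne u hu j)).continuousAt.continuousWithinAt
  refine ⟨|D| * C, by positivity, fun u hu m => ?_⟩
  rw [PhiLog_eq_PLog_mul_QLog hN hq0 hq (fun j => log (a j) / log q) _ fun j =>
    qPoch_shift_ne_zero hq0 hq (ha0 j) m (hne u hu j), PLog_add_nat_mul_log hN hq0 hq hs, norm_mul,
    mul_assoc]
  exact mul_le_mul ((hD u hu).trans (le_abs_self _)) (hC u hu m) (norm_nonneg _) (abs_nonneg _)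

end
-- Standing hypotheses and reduction to a fundamental interval of radii.
/-- The standing hypotheses on the parameters. -/
structure Admissible (N : ℕ) (q : ℂ) (a : Fin (2 * N) → ℂ) : Prop where
  two_le : 2 ≤ N
  q_ne_zero : q ≠ 0
  norm_q : ‖q‖ < 1
  norm_a : ∀ j, ‖a j‖ < 1
  odd : Odd N → (0 < q.re ∧ q.im = 0) ∧ ∀ j, a j ∈ Complex.slitPlane
  cond : ‖q ^ (N - 1)‖ < ‖∏ j, a j‖

section
variable (N : ℕ) (q : ℂ) (a : Fin (2 * N) → ℂ)

/-- The jump of `Φ` across the cut, at `-e^x`. -/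
noncomputable def edge (x : ℝ) : ℂ :=
  PhiLog N q a (x + Real.pi * I) - PhiLog N q a (x - Real.pi * I)

/-- The exponent with which `Φ(z)` decays as `z → 0`. -/
noncomputable def decayRate : ℝ := Real.log ‖q ^ (N - 1) / ∏ j, a j‖ / Real.log ‖q‖

/-- The integral of `Φ(z) dz / (i z)` over the circle of radius `e^t`. -/
noncomputable def verticalIntegral (t : ℝ) : ℂ :=
  ∫ θ in (-Real.pi)..Real.pi, PhiLog N q a (t + θ * I)

/-- The circle of radius `e^t` does not meet the orbits `a_k q^ℤ`. -/
def AvoidsPoles (t : ℝ) : Prop := ∀ (k : Fin (2 * N)) (n : ℤ), t ≠ Real.log ‖a k‖ + n * Real.log ‖q‖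

end

lemma exists_nat_sub_mem_Icc {l x : ℝ} (hl : l < 0) (hx : x ≤ 0) :
    ∃ m : ℕ, x - m * l ∈ Set.Icc l 0 := by
  have h0 : 0 ≤ x / l := div_nonneg_of_nonpos hx hl.le
  have h1 := Nat.floor_le h0
  have h2 := (Nat.lt_floor_add_one (x / l)).le
  rw [le_div_iff_of_neg hl] at h1
  rw [div_le_iff_of_neg hl] at h2
  exact ⟨⌊x / l⌋₊, by constructor <;> linarith⟩

lemma exists_int_sub_mem_Icc (y : ℝ) :
    ∃ n : ℤ, y - n * (2 * Real.pi) ∈ Set.Icc (-Real.pi) Real.pi := by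
  have hπ := Real.pi_pos
  refine ⟨round (y / (2 * Real.pi)), ?_⟩
  have h := abs_le.1 (abs_sub_round (y / (2 * Real.pi)))
  have e : y = y / (2 * Real.pi) * (2 * Real.pi) := by field_simp
  constructor <;> nlinarith

/-- Points are classified by which elements of `B` lie below them. Only finitely many classes occur,
and no element of `B` separates two points of one class. -/
lemma exists_finite_representatives {A B : Set ℝ} (hB : B.Finite) :
    ∃ M : Set ℝ, M.Finite ∧ M ⊆ A \ B ∧ ∀ x ∈ A \ B, ∃ y ∈ M, ∀ b ∈ Set.uIcc x y, b ∉ B := by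
  set g : ℝ → Set ℝ := fun x => {b ∈ B | b < x} with hg
  obtain ⟨M, hM, hbij⟩ := Set.exists_subset_bijOn (A \ B) g
  refine ⟨M, hbij.finite_iff_finite.2 (hB.finite_subsets.subset ?_), hM, fun x hx => ?_⟩
  · rintro _ ⟨x, -, rfl⟩
    exact fun b hb => hb.1
  · obtain ⟨y, hy, hxy⟩ := hbij.surjOn (Set.mem_image_of_mem g hx)
    refine ⟨y, hy, fun b hb hbB => ?_⟩
    have hbx : b ≠ x := fun h => hx.2 (h ▸ hbB)
    have hby : b ≠ y := fun h => (hM hy).2 (h ▸ hbB)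
    have hiff : b < y ↔ b < x := by
      have := Set.ext_iff.1 hxy b
      simpa [hg, hbB] using this
    rcases Set.mem_uIcc.1 hb with h | h
    · exact absurd (hiff.1 (lt_of_le_of_ne h.2 hby)) (not_lt.2 h.1)
    · exact absurd (hiff.2 (lt_of_le_of_ne h.2 hbx)) (not_lt.2 h.1)

lemma norm_exp_eq_iff {c q u : ℂ} (hc : c ≠ 0) (hq0 : q ≠ 0) {n : ℤ} (h : exp u = c * q ^ n) :
    u.re = Real.log ‖c‖ + n * Real.log ‖q‖ := by
  have h1 := congrArg (fun z => Real.log ‖z‖) h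
  simp only [norm_exp, Real.log_exp, norm_mul, norm_zpow] at h1
  rwa [Real.log_mul (norm_ne_zero_iff.2 hc) (zpow_ne_zero _ (norm_ne_zero_iff.2 hq0)),
    Real.log_zpow] at h1

namespace Admissible
variable {N : ℕ} {q : ℂ} {a : Fin (2 * N) → ℂ} (H : Admissible N q a)
include H

lemma N_pos : 0 < N := by linarith [H.two_le]

lemma a_ne_zero (j : Fin (2 * N)) : a j ≠ 0 := ne_zero_of_cond H.cond j

lemma log_norm_q_neg : Real.log ‖q‖ < 0 := Real.log_neg (norm_pos_iff.2 H.q_ne_zero) H.norm_q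

lemma ratio_pos : 0 < ‖q ^ (N - 1) / ∏ j, a j‖ :=
  norm_pos_iff.2 (div_ne_zero (pow_ne_zero _ H.q_ne_zero)
    (Finset.prod_ne_zero_iff.2 fun j _ => H.a_ne_zero j))

lemma ratio_lt_one : ‖q ^ (N - 1) / ∏ j, a j‖ < 1 := by
  rw [norm_div, div_lt_one (lt_of_le_of_lt (norm_nonneg _) H.cond)]
  exact H.cond

lemma decayRate_pos : 0 < decayRate N q a :=
  div_pos_of_neg_of_neg (Real.log_neg H.ratio_pos H.ratio_lt_one) H.log_norm_q_neg

lemma ratio_pow (m : ℕ) : ‖q ^ (N - 1) / ∏ j, a j‖ ^ m =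
    Real.exp (decayRate N q a * (m * Real.log ‖q‖)) := by
  have := H.log_norm_q_neg.ne
  nth_rw 1 [← Real.exp_log H.ratio_pos]
  rw [← Real.exp_nat_mul, decayRate]
  congr 1; field_simp

/-- The geometric bound becomes a power of `|z|`; the loss `exp(-δ log|q|)`, with `δ` the decay
rate, pays for the position of `u` within one period. -/
lemma exists_decay {K : Set ℂ} (hK : IsCompact K) (hre : ∀ u ∈ K, u.re ∈ Set.Icc (Real.log ‖q‖) 0)
    (hne : ∀ u ∈ K, ∀ j (n : ℤ), exp u ≠ a j * q ^ n) :
    ∃ C, 0 ≤ C ∧ ∀ u ∈ K, ∀ m : ℕ, ‖PhiLog N q a (u + m * log q)‖ ≤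
      C * Real.exp (decayRate N q a * (u.re + m * Real.log ‖q‖)) := by
  obtain ⟨C, hC0, hC⟩ := exists_PhiLog_bound H.q_ne_zero H.norm_q H.N_pos H.norm_a H.a_ne_zero hK
    (fun u hu => (hre u hu).2) hne
  refine ⟨C * Real.exp (-(decayRate N q a * Real.log ‖q‖)), by positivity, fun u hu m => ?_⟩
  refine (hC u hu m).trans ?_
  rw [H.ratio_pow, mul_assoc, ← Real.exp_add]
  gcongr
  nlinarith [(hre u hu).1, H.decayRate_pos]

/-- Multiplication by powers of a positive `q` preserves the negative axis, so no orbit of a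
parameter off the cut ever meets it. -/
lemma exp_ne_of_im_eq_pi (hN : Odd N) {u : ℂ} (hu : u.im = Real.pi ∨ u.im = -Real.pi)
    (j : Fin (2 * N)) (n : ℤ) : exp u ≠ a j * q ^ n := by
  intro h
  obtain ⟨⟨hq, hqi⟩, ha⟩ := H.odd hN
  have hqr : q = (q.re : ℂ) := by apply Complex.ext <;> simp [hqi]
  have he : exp u = ((-Real.exp u.re : ℝ) : ℂ) := by
    apply Complex.ext
    · rcases hu with h | h <;> simp [exp_re, h]
    · rcases hu with h | h <;> simp [exp_im, h]
  have hzp : q ^ n ≠ 0 := zpow_ne_zero _ H.q_ne_zero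
  have haj : a j = ((-Real.exp u.re / q.re ^ n : ℝ) : ℂ) := by
    rw [eq_comm, ofReal_div, ofReal_zpow, ← hqr, ← he, h]
    field_simp
  have := ha j
  rw [haj, ofReal_mem_slitPlane] at this
  exact absurd this (not_lt.2 (div_nonpos_of_nonpos_of_nonneg
    (neg_nonpos.2 (Real.exp_pos _).le) (zpow_pos hq n).le))

lemma log_q_eq (hN : Odd N) : log q = (Real.log ‖q‖ : ℝ) := by
  obtain ⟨⟨hq, hqi⟩, -⟩ := H.odd hN
  have hqr : q = (q.re : ℂ) := by apply Complex.ext <;> simp [hqi]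
  rw [hqr, ← ofReal_log hq.le, norm_real, Real.norm_of_nonneg hq.le]

/-! ### The jump of Φ across the cut and the convergence of the integrals. -/

lemma differentiableAt_PhiLog_of_re {u : ℂ} (hu : u.re ≤ 0)
    (h : ∀ j (n : ℕ), exp u ≠ a j * q ^ n) : DifferentiableAt ℂ (PhiLog N q a) u :=
  differentiableAt_PhiLog H.N_pos H.q_ne_zero H.norm_q
    (PhiDen_ne_zero H.norm_q H.norm_a hu h)

omit H in
lemma edge_of_even (hN : Even N) (x : ℝ) : edge N q a x = 0 := by
  have := PhiLog_add_int_of_even (q := q) (a := a) hN (x - Real.pi * I) 1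
  rw [edge, ← this, sub_eq_zero]
  congr 1; push_cast; ring

omit H in
-- Inversion `z ↦ 1/z` fixes Φ and exchanges the two edges, so the cut inside the unit disc can
-- replace the cut outside.
lemma edge_neg (x : ℝ) : edge N q a (-x) = -edge N q a x := by
  rw [edge, edge, ← PhiLog_neg (x + _), ← PhiLog_neg (x - _)]
  push_cast
  rw [neg_sub]
  congr 2 <;> ring

lemma continuous_edge : Continuous (edge N q a) := by
  rcases Nat.even_or_odd N with hN | hN
  · rw [show edge N q a = fun _ => 0 from funext (edge_of_even hN)]
    exact continuous_const
  · have hd : ∀ u : ℂ, u.im = Real.pi ∨ u.im = -Real.pi → ContinuousAt (PhiLog N q a) u := by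
      intro u hu
      rcases le_total u.re 0 with h | h
      · exact (H.differentiableAt_PhiLog_of_re h fun j n => by
          exact_mod_cast H.exp_ne_of_im_eq_pi hN hu j n).continuousAt
      · have h1 : ContinuousAt (PhiLog N q a) (-u) :=
          (H.differentiableAt_PhiLog_of_re (by simpa using h) fun j n => by
            exact_mod_cast H.exp_ne_of_im_eq_pi hN (u := -u) (by
              rcases hu with h | h <;> simp [h]) j n).continuousAt
        have h2 : PhiLog N q a = PhiLog N q a ∘ Neg.neg := funext fun u => (PhiLog_neg u).symm
        rw [h2]
        exact ContinuousAt.comp h1 continuous_neg.continuousAt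
    rw [continuous_iff_continuousAt]
    intro x
    refine ContinuousAt.sub ?_ ?_
    · exact ContinuousAt.comp (f := fun x : ℝ => (x : ℂ) + Real.pi * I) (hd _ (by simp))
        (by fun_prop)
    · exact ContinuousAt.comp (f := fun x : ℝ => (x : ℂ) - Real.pi * I) (hd _ (by simp))
        (by fun_prop)

/-- Oddness reduces to `x ≤ 0`. For odd `N` one period of the two edges is a compact set free of
poles, so the uniform decay applies; for even `N` there is no jump. -/
lemma exists_edge_bound :
    ∃ C, 0 ≤ C ∧ ∀ x : ℝ, ‖edge N q a x‖ ≤ C * Real.exp (-(decayRate N q a * |x|)) := by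
  suffices h : ∃ C, 0 ≤ C ∧ ∀ x ≤ 0, ‖edge N q a x‖ ≤ C * Real.exp (decayRate N q a * x) by
    obtain ⟨C, h0, hC⟩ := h
    refine ⟨C, h0, fun x => ?_⟩
    rcases le_total x 0 with hx | hx
    · simpa [abs_of_nonpos hx] using hC x hx
    · have := hC (-x) (by linarith)
      rw [edge_neg, norm_neg] at this
      simpa [abs_of_nonneg hx] using this
  rcases Nat.even_or_odd N with hN | hN
  · exact ⟨0, le_rfl, fun x _ => by simp [edge_of_even hN]⟩
  · have hK : IsCompact (Set.Icc (Real.log ‖q‖) 0 ×ℂ {Real.pi, -Real.pi}) :=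
      isCompact_Icc.reProdIm (Set.toFinite _).isCompact
    obtain ⟨C, h0, hC⟩ := H.exists_decay hK (fun u hu => (mem_reProdIm.1 hu).1)
      fun u hu => H.exp_ne_of_im_eq_pi hN (mem_reProdIm.1 hu).2
    refine ⟨C + C, by positivity, fun x hx => ?_⟩
    obtain ⟨m, hm⟩ := exists_nat_sub_mem_Icc H.log_norm_q_neg hx
    have key : ∀ y : ℝ, y = Real.pi ∨ y = -Real.pi →
        ‖PhiLog N q a (x + y * I)‖ ≤ C * Real.exp (decayRate N q a * x) := by
      intro y hy
      have := hC ((x - m * Real.log ‖q‖ : ℝ) + y * I) (by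
        exact mem_reProdIm.2 ⟨by simpa using hm, by simpa using hy⟩) m
      -- As `q > 0`, its logarithm is real and the shifts stay on the same edge.
      rw [H.log_q_eq hN] at this
      convert this using 3
      · push_cast; ring
      · simp
    rw [edge, add_mul]
    refine (norm_sub_le _ _).trans (add_le_add (key _ (Or.inl rfl)) ?_)
    simpa [sub_eq_add_neg] using key _ (Or.inr rfl)

lemma integrableOn_tailIntegrand : IntegrableOn (tailIntegrand N q a) (Set.Ioi 1) := by
  obtain ⟨C, h0, hC⟩ := H.exists_edge_bound
  have hδ := H.decayRate_pos
  have hint := (integrableOn_Ioi_rpow_of_lt (a := -1 - decayRate N q a) (by linarith)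
    one_pos).const_mul C
  refine Integrable.mono' hint ?_ ?_
  · refine ContinuousOn.aestronglyMeasurable (fun x hx => ?_) measurableSet_Ioi
    have hx0 : x ≠ 0 := (lt_trans one_pos hx).ne'
    have h1 : ContinuousAt (fun x : ℝ => edge N q a (Real.log x)) x :=
      ContinuousAt.comp H.continuous_edge.continuousAt (Real.continuousAt_log hx0)
    exact (h1.div Complex.continuous_ofReal.continuousAt (by exact_mod_cast hx0)).continuousWithinAt
  · filter_upwards [ae_restrict_mem measurableSet_Ioi] with x hx
    have hx' : (1 : ℝ) < x := hx
    have hx0 : 0 < x := by linarith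
    change ‖edge N q a (Real.log x) / x‖ ≤ _
    rw [norm_div, norm_real, Real.norm_of_nonneg hx0.le, div_le_iff₀ hx0]
    refine (hC _).trans (le_of_eq ?_)
    rw [abs_of_pos (Real.log_pos hx'), mul_assoc]
    congr 1
    nth_rw 3 [← Real.rpow_one x]
    rw [← Real.rpow_add hx0, Real.rpow_def_of_pos hx0]
    congr 1; ring

lemma tendsto_integral_edge : Tendsto (fun T : ℝ => ∫ x in (0 : ℝ)..T, edge N q a x) atTop
    (𝓝 (∫ x in Set.Ioi (1 : ℝ), tailIntegrand N q a x)) := by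
  have h := intervalIntegral_tendsto_integral_Ioi 1 H.integrableOn_tailIntegrand
    Real.tendsto_exp_atTop
  refine h.congr' ?_
  filter_upwards [eventually_ge_atTop 0] with T hT
  have h1 : (1 : ℝ) ≤ Real.exp T := Real.one_le_exp hT
  have hpos : ∀ x ∈ Set.uIcc 1 (Real.exp T), x ≠ 0 := by
    intro x hx
    rw [Set.uIcc_of_le h1] at hx
    linarith [hx.1]
  have := intervalIntegral.integral_deriv_smul_comp (a := 1) (b := Real.exp T) (f := Real.log)
    (f' := fun x => x⁻¹) (g := edge N q a) (fun x hx => Real.hasDerivAt_log (hpos x hx))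
    (continuousOn_inv₀.mono hpos) H.continuous_edge
  rw [Real.log_one, Real.log_exp] at this
  rw [← this]
  apply intervalIntegral.integral_congr
  intro x _
  simp [tailIntegrand, edge, div_eq_inv_mul]

omit H in
lemma Phi_exp {t θ : ℝ} (hθ : θ ∈ Set.Ioc (-Real.pi) Real.pi) :
    Phi N q a (exp (t + θ * I)) = PhiLog N q a (t + θ * I) := by
  rw [Phi, log_exp (by simpa using hθ.1) (by simpa using hθ.2)]

omit H in
lemma circleIntegral_Phi (t : ℝ) :
    (∮ z in C(0, Real.exp t), Phi N q a z / z) = I * verticalIntegral N q a t := by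
  rw [circleIntegral_eq_integral_exp, verticalIntegral]
  congr 1
  apply intervalIntegral.integral_congr_ae
  refine Eventually.of_forall fun θ hθ => ?_
  rw [Set.uIoc_of_le (by linarith [Real.pi_pos])] at hθ
  rw [Phi_exp hθ, mul_div_cancel₀ _ (exp_ne_zero _)]

lemma continuous_PhiLog_vertical {t : ℝ} (ht : t ≤ 0)
    (h : ∀ k (n : ℕ), t ≠ Real.log ‖a k‖ + n * Real.log ‖q‖) :
    Continuous fun θ : ℝ => PhiLog N q a (t + θ * I) := by
  rw [continuous_iff_continuousAt]
  intro θ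
  refine ContinuousAt.comp (f := fun θ : ℝ => (t : ℂ) + θ * I)
    (H.differentiableAt_PhiLog_of_re (by simpa using ht) fun j n hn => h j n ?_).continuousAt
    (by fun_prop)
  have := norm_exp_eq_iff (n := n) (H.a_ne_zero j) H.q_ne_zero (by exact_mod_cast hn)
  simpa using this

lemma zero_ne_log (k : Fin (2 * N)) (n : ℕ) : (0 : ℝ) ≠ Real.log ‖a k‖ + n * Real.log ‖q‖ := by
  have h1 := Real.log_neg (norm_pos_iff.2 (H.a_ne_zero k)) (H.norm_a k)
  have h2 := mul_nonpos_of_nonneg_of_nonpos n.cast_nonneg H.log_norm_q_neg.le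
  linarith

/-- For odd `N` the principal branch may jump at `-1`, so integrability is taken from the continuous
lift `PhiLog` over one period starting at `-π`. -/
lemma circleIntegrable_Phi : CircleIntegrable (fun z => Phi N q a z / z) 0 1 := by
  have hper : Function.Periodic (fun θ : ℝ => (fun z => Phi N q a z / z) (circleMap 0 1 θ))
      (2 * Real.pi) := fun θ => by simp only [periodic_circleMap 0 1 θ]
  refine hper.intervalIntegrable (t := -Real.pi) (by positivity) ?_ _ _
  rw [show -Real.pi + 2 * Real.pi = Real.pi by ring]
  have hc : Continuous fun θ : ℝ => PhiLog N q a ((0 : ℝ) + θ * I) / exp (θ * I) :=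
    (H.continuous_PhiLog_vertical le_rfl H.zero_ne_log).div (by fun_prop) fun θ => exp_ne_zero _
  refine (hc.intervalIntegrable _ _).congr ?_
  intro θ hθ
  rw [Set.uIoc_of_le (by linarith [Real.pi_pos])] at hθ
  have : circleMap 0 1 θ = exp ((0 : ℝ) + θ * I) := by simp [circleMap]
  simp only [this, Phi_exp hθ]
  simp

/-! ### Decay of the integral over small circles. -/

/-- Cauchy's theorem between two circles with no pole of `Φ` between them. -/
lemma norm_verticalIntegral_sub_le {C : ℝ} (h0 : 0 ≤ C)
    (hC : ∀ x : ℝ, ‖edge N q a x‖ ≤ C * Real.exp (-(decayRate N q a * |x|))) {t t' : ℝ}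
    (ht : t ≤ 0) (ht' : t' ≤ 0) (h : ∀ b ∈ Set.uIcc t t', AvoidsPoles N q a b) :
    ‖verticalIntegral N q a t - verticalIntegral N q a t'‖ ≤
      C * Real.exp (decayRate N q a * max t t') * |t - t'| := by
  wlog htt : t < t' generalizing t t'
  · rcases eq_or_lt_of_le (not_lt.1 htt) with rfl | hlt
    · simp
    · rw [norm_sub_rev, max_comm, abs_sub_comm]
      exact this ht' ht (by rwa [Set.uIcc_comm]) hlt
  have hne : ∀ u : ℂ, u.re ∈ Set.Icc t t' → ∀ j (n : ℕ), exp u ≠ a j * q ^ n := by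
    intro u hu j n hn
    rw [Set.uIcc_of_le htt.le] at h
    have := norm_exp_eq_iff (n := n) (H.a_ne_zero j) H.q_ne_zero (by exact_mod_cast hn)
    exact h u.re hu j n this
  -- With no poles in between, the two circle integrals differ only by the contribution of the cut.
  have hrect := integral_rect_eq_sum_residues (∅ : Finset ℕ) 0 0 (by simp) (PhiLog N q a) htt
    (by simp) (fun u hu _ _ => H.differentiableAt_PhiLog_of_re (hu.2.trans ht') (hne u hu))
    (fun u => (eventually_PhiDen_ne_zero H.norm_q H.norm_a u).mono fun w hw =>
      differentiableAt_PhiLog H.N_pos H.q_ne_zero H.norm_q hw) (by simp)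
  have h1 : I * (verticalIntegral N q a t' - verticalIntegral N q a t) =
      ∫ x in t..t', edge N q a x := by
    simp only [Finset.sum_empty, mul_zero] at hrect
    unfold verticalIntegral edge
    linear_combination hrect
  have h2 : ‖verticalIntegral N q a t - verticalIntegral N q a t'‖ =
      ‖∫ x in t..t', edge N q a x‖ := by
    rw [← h1, norm_mul, norm_I, one_mul, norm_sub_rev]
  rw [h2, abs_sub_comm]
  refine intervalIntegral.norm_integral_le_of_norm_le_const fun x hx => ?_
  rw [Set.uIoc_of_le htt.le] at hx
  refine (hC x).trans ?_
  rw [abs_of_nonpos (hx.2.trans ht'), max_eq_right htt.le]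
  have := H.decayRate_pos
  gcongr
  nlinarith [hx.2]

lemma exists_verticalIntegral_bound {τ : ℝ} (hτ : τ ∈ Set.Icc (Real.log ‖q‖) 0)
    (h : AvoidsPoles N q a τ) :
    ∃ C, 0 ≤ C ∧ ∀ m : ℕ, ‖verticalIntegral N q a (τ + m * Real.log ‖q‖)‖ ≤
      C * Real.exp (decayRate N q a * (τ + m * Real.log ‖q‖)) := by
  have hK : IsCompact ({τ} ×ℂ Set.Icc (-Real.pi) Real.pi) :=
    isCompact_singleton.reProdIm isCompact_Icc
  obtain ⟨C, h0, hC⟩ := H.exists_decay hK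
    (fun u hu => by rw [show u.re = τ from (mem_reProdIm.1 hu).1]; exact hτ)
    fun u hu j n hn => h j n (by
      rw [← norm_exp_eq_iff (H.a_ne_zero j) H.q_ne_zero hn]
      exact (mem_reProdIm.1 hu).1.symm)
  refine ⟨C * |Real.pi - -Real.pi|, by positivity, fun m => ?_⟩
  rw [mul_right_comm]
  refine intervalIntegral.norm_integral_le_of_norm_le_const fun θ _ => ?_
  -- For non-real `q` the shift by `m log q` also rotates the circle. The angle is brought back to
  -- `[-π, π]`, which leaves the modulus of Φ unchanged.
  obtain ⟨n, hn⟩ := exists_int_sub_mem_Icc (θ - m * (log q).im)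
  have := hC (τ + ((θ - m * (log q).im - n * (2 * Real.pi) : ℝ) : ℂ) * I) (by
    rw [mem_reProdIm]; simpa using hn) m
  rw [← norm_PhiLog_add_int _ n] at this
  have hlog : log q = (Real.log ‖q‖ : ℝ) + (log q).im * I := by
    apply Complex.ext <;> simp [log_re]
  have e1 : (τ : ℂ) + ((θ - m * (log q).im - n * (2 * Real.pi) : ℝ) : ℂ) * I + m * log q +
      n * (2 * Real.pi * I) = ((τ + m * Real.log ‖q‖ : ℝ) : ℂ) + θ * I := by
    push_cast
    linear_combination (m : ℂ) * hlog
  have e2 : ((τ : ℂ) + ((θ - m * (log q).im - n * (2 * Real.pi) : ℝ) : ℂ) * I).re = τ := by simp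
  rwa [e1, e2] at this

lemma finite_poles_inter (l u : ℝ) : {b ∈ Set.Icc l u | ¬ AvoidsPoles N q a b}.Finite := by
  have hl := H.log_norm_q_neg
  have : {b ∈ Set.Icc l u | ¬ AvoidsPoles N q a b} ⊆ ⋃ k : Fin (2 * N),
      (fun n : ℤ => Real.log ‖a k‖ + n * Real.log ‖q‖) ''
        Set.Icc ⌈(u - Real.log ‖a k‖) / Real.log ‖q‖⌉ ⌊(l - Real.log ‖a k‖) / Real.log ‖q‖⌋ := by
    rintro b ⟨hb, hbad⟩
    simp only [AvoidsPoles, not_forall, not_not] at hbad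
    obtain ⟨k, n, rfl⟩ := hbad
    refine Set.mem_iUnion.2 ⟨k, n, ⟨?_, ?_⟩, rfl⟩
    · rw [Int.ceil_le, div_le_iff_of_neg hl]; linarith [hb.2]
    · rw [Int.le_floor, le_div_iff_of_neg hl]; linarith [hb.1]
  exact (Set.finite_iUnion fun k => (Set.finite_Icc _ _).image _).subset this

omit H in
lemma AvoidsPoles.add_nat {t : ℝ} (h : AvoidsPoles N q a t) (m : ℕ) :
    AvoidsPoles N q a (t + m * Real.log ‖q‖) := fun k n hn =>
  h k (n - m) (by push_cast; linarith)

omit H in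
lemma AvoidsPoles.sub_nat {t : ℝ} (h : AvoidsPoles N q a t) (m : ℕ) :
    AvoidsPoles N q a (t - m * Real.log ‖q‖) := fun k n hn =>
  h k (n + m) (by push_cast; linarith)

/-- A pointwise bound on Φ degenerates as the circle approaches a pole. Modulo `log|q|`, however,
the pole radii cut the fundamental interval into finitely many gaps. One representative circle per
gap is bounded directly, and any other circle is moved to it by Cauchy's theorem at the cost of an
edge integral. -/
lemma exists_verticalIntegral_decay : ∃ C, 0 ≤ C ∧ ∀ t ≤ 0, AvoidsPoles N q a t →
    ‖verticalIntegral N q a t‖ ≤ C * Real.exp (decayRate N q a * t) := by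
  have hl := H.log_norm_q_neg
  have hδ := H.decayRate_pos
  set l := Real.log ‖q‖ with hldef
  obtain ⟨C, h0, hC⟩ := H.exists_edge_bound
  obtain ⟨M, hMfin, hMsub, hM⟩ := exists_finite_representatives (A := Set.Icc l 0)
    (H.finite_poles_inter l 0)
  have hMb : ∀ y : ℝ, ∃ D, 0 ≤ D ∧ (y ∈ M → ∀ m : ℕ, ‖verticalIntegral N q a (y + m * l)‖ ≤
      D * Real.exp (decayRate N q a * (y + m * l))) := by
    intro y
    by_cases hy : y ∈ M
    · have h1 := hMsub hy
      obtain ⟨D, hD0, hD⟩ := H.exists_verticalIntegral_bound h1.1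
        (by by_contra h; exact h1.2 ⟨h1.1, h⟩)
      exact ⟨D, hD0, fun _ => hD⟩
    · exact ⟨0, le_rfl, fun h => absurd h hy⟩
  choose D hD0 hD using hMb
  obtain ⟨E, hE⟩ := (hMfin.image D).bddAbove
  -- `|E|` bounds the representatives and `C|l|` the move, which has length at most `|l|`. The
  -- exponential factor allows for the representative lying up to `|l|` to the right of `t`.
  refine ⟨(|E| + C * |l|) * Real.exp (-(decayRate N q a * l)), by positivity, fun t ht hgood => ?_⟩
  obtain ⟨m, hm⟩ := exists_nat_sub_mem_Icc hl ht
  obtain ⟨y, hy, hb⟩ := hM (t - m * l) ⟨hm, fun h => h.2 (AvoidsPoles.sub_nat hgood m)⟩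
  have hyI := (hMsub hy).1
  have hy0 : y + m * l ≤ 0 := by
    have := mul_nonpos_of_nonneg_of_nonpos (Nat.cast_nonneg (α := ℝ) m) hl.le
    linarith [hyI.2]
  have h1 := H.norm_verticalIntegral_sub_le h0 hC (t := t) (t' := y + m * l) ht hy0 (by
    intro b hb'
    have hmem : b - m * l ∈ Set.uIcc (t - m * l) y := by
      rcases Set.mem_uIcc.1 hb' with h | h
      · exact Set.mem_uIcc.2 (Or.inl ⟨by linarith [h.1], by linarith [h.2]⟩)
      · exact Set.mem_uIcc.2 (Or.inr ⟨by linarith [h.1], by linarith [h.2]⟩)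
    have h2 := hb _ hmem
    have h3 : b - m * l ∈ Set.Icc l 0 := Set.uIcc_subset_Icc hm hyI hmem
    have h4 : AvoidsPoles N q a (b - m * l) := by
      by_contra h
      exact h2 ⟨h3, h⟩
    have h5 := AvoidsPoles.add_nat h4 m
    rwa [← hldef, sub_add_cancel] at h5)
  have h2 := hD y hy m
  have hDE : D y ≤ |E| := (hE (Set.mem_image_of_mem D hy)).trans (le_abs_self _)
  have hle : y + m * l ≤ t - l := by linarith [hm.1, hyI.2]
  have hexp : ∀ x ≤ t - l, Real.exp (decayRate N q a * x) ≤
      Real.exp (-(decayRate N q a * l)) * Real.exp (decayRate N q a * t) := by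
    intro x hx
    rw [← Real.exp_add, Real.exp_le_exp]
    nlinarith
  have habs : |t - (y + m * l)| ≤ |l| := by
    rw [abs_of_neg hl, abs_le]
    constructor <;> linarith [hm.1, hm.2, hyI.1, hyI.2]
  have h3 := norm_le_norm_add_norm_sub' (verticalIntegral N q a t) (verticalIntegral N q a (y + m * l))
  have h4 : ‖verticalIntegral N q a (y + m * l)‖ ≤
      |E| * (Real.exp (-(decayRate N q a * l)) * Real.exp (decayRate N q a * t)) :=
    h2.trans (mul_le_mul hDE (hexp _ hle) (Real.exp_pos _).le (abs_nonneg _))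
  have h5 : C * Real.exp (decayRate N q a * max t (y + m * l)) * |t - (y + m * l)| ≤
      C * (Real.exp (-(decayRate N q a * l)) * Real.exp (decayRate N q a * t)) * |l| := by
    have := hexp (max t (y + m * l)) (max_le (by linarith) hle)
    gcongr
  calc _ ≤ _ := h3
    _ ≤ _ := add_le_add h4 (h1.trans h5)
    _ = _ := by ring

lemma tendsto_IEps : Tendsto (IEps N q a)
    (𝓝[>] (0 : ℝ) ⊓ 𝓟 {ε : ℝ | ∀ (k : Fin (2 * N)) (ν : ℕ), ε ≠ ‖a k * q ^ ν‖}) (𝓝 0) := by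
  obtain ⟨C, h0, hC⟩ := H.exists_verticalIntegral_decay
  have hδ := H.decayRate_pos
  have hl := H.log_norm_q_neg
  have hlim : Tendsto (fun ε : ℝ => ‖(2 * (Real.pi : ℂ) * I)⁻¹ * I‖ *
      (C * Real.exp (decayRate N q a * Real.log ε))) (𝓝[>] 0) (𝓝 0) := by
    have h1 : Tendsto (fun ε => decayRate N q a * Real.log ε) (𝓝[>] 0) atBot :=
      Real.tendsto_log_nhdsGT_zero.const_mul_atBot hδ
    have h2 := ((Real.tendsto_exp_atBot.comp h1).const_mul C).const_mul
      ‖(2 * (Real.pi : ℂ) * I)⁻¹ * I‖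
    simpa using h2
  refine squeeze_zero_norm' ?_ (hlim.mono_left inf_le_left)
  rw [eventually_inf_principal]
  -- Below every `|a_k|` no radius `|a_k q^n|` with `n < 0` can occur, so avoiding `ν ≥ 0` means
  -- avoiding the whole orbits.
  have hsmall : ∀ᶠ ε in 𝓝[>] (0 : ℝ), ∀ k : Fin (2 * N), ε < ‖a k‖ :=
    eventually_all.2 fun k => Filter.Eventually.filter_mono nhdsWithin_le_nhds
      (eventually_lt_nhds (norm_pos_iff.2 (H.a_ne_zero k)))
  filter_upwards [hsmall, self_mem_nhdsWithin] with ε hε hpos hgood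
  have hpos : 0 < ε := hpos
  have k0 : Fin (2 * N) := ⟨0, by linarith [H.N_pos]⟩
  have hlog : Real.log ε ≤ 0 := Real.log_nonpos hpos.le ((hε k0).trans (H.norm_a k0)).le
  have havoid : AvoidsPoles N q a (Real.log ε) := by
    intro k n hn
    have h1 := Real.log_lt_log hpos (hε k)
    have hn0 : 0 ≤ n := by
      by_contra hneg
      have : (n : ℝ) ≤ 0 := by exact_mod_cast (not_le.1 hneg).le
      nlinarith
    obtain ⟨ν, rfl⟩ := Int.eq_ofNat_of_zero_le hn0
    apply hgood k ν
    rw [← Real.exp_log hpos, hn, norm_mul, norm_pow, Real.exp_add,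
      Real.exp_log (norm_pos_iff.2 (H.a_ne_zero k)), Int.cast_natCast, Real.exp_nat_mul,
      Real.exp_log (norm_pos_iff.2 H.q_ne_zero)]
  have := hC _ hlog havoid
  have e : IEps N q a ε = (2 * (Real.pi : ℂ) * I)⁻¹ * I * verticalIntegral N q a (Real.log ε) := by
    have := circleIntegral_Phi (N := N) (q := q) (a := a) (Real.log ε)
    rw [Real.exp_log hpos] at this
    rw [IEps, this, ← mul_assoc]
  rw [e, norm_mul]
  gcongr

end Admissible
-- Residues of P, the coefficients `R_k`, and the Jackson sums.
section
variable (N : ℕ) (q : ℂ) (a : Fin (2 * N) → ℂ) (s : Fin (2 * N) → ℂ)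

/-- The product of the nonvanishing factors of the denominator of `P` near `z = a_k`. -/
noncomputable def PDenAt (k : Fin (2 * N)) (w : ℂ) : ℂ :=
  (∏ j, exp ((1 / 2 - s j) * w)) * ((∏ j ∈ Finset.univ.erase k, theta (a j * exp (-w)) q) *
    (qPoch (a k * exp (-w) * q) q * qPoch (q * (a k)⁻¹ * exp w) q))

/-- The function `P(z) (1 - a_k / z)`, which is regular at `z = a_k`. -/
noncomputable def PReg (k : Fin (2 * N)) (w : ℂ) : ℂ :=
  exp ((N : ℂ) / 2 * w) * theta (exp (-(N * w))) (q ^ ((N : ℂ) / 2)) / PDenAt N q a s k w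

end

namespace Admissible
variable {N : ℕ} {q : ℂ} {a : Fin (2 * N) → ℂ} (H : Admissible N q a) {s : Fin (2 * N) → ℂ}
include H

/-- The factor `1 - a_k/z` is split off `θ(a_k/z)`; what remains is regular at `a_k`, and the split
factor becomes the kernel `z/(z - a_k)` with residue one in `u`. -/
lemma PLog_eq_PReg_mul (k : Fin (2 * N)) (w : ℂ) :
    PLog N q a s w = PReg N q a s k w * (exp w / (exp w - a k)) := by
  have h1 : exp w / (exp w - a k) = (1 - a k * exp (-w))⁻¹ := by
    have h2 : exp w - a k = exp w * (1 - a k * exp (-w)) := by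
      rw [exp_neg]; have := exp_ne_zero w; field_simp
    rw [h2, div_eq_mul_inv, mul_inv, mul_inv_cancel_left₀ (exp_ne_zero w)]
  have h2 : (a k * exp (-w))⁻¹ = (a k)⁻¹ * exp w := by rw [mul_inv, ← exp_neg, neg_neg]
  have h3 : theta (a k * exp (-w)) q = (1 - a k * exp (-w)) *
      (qPoch (a k * exp (-w) * q) q * qPoch (q * (a k)⁻¹ * exp w) q) := by
    rw [theta, qPoch_succ H.norm_q (a k * exp (-w)), h2]
    ring_nf
  rw [PLog, PReg, PDenAt, Finset.prod_mul_distrib,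
    ← Finset.mul_prod_erase _ (fun j => theta (a j * exp (-w)) q) (Finset.mem_univ k), h3, h1,
    ← div_eq_mul_inv _ (1 - a k * exp (-w)), div_div]
  congr 1
  ring

lemma differentiable_PDenAt (k : Fin (2 * N)) : Differentiable ℂ (PDenAt N q a s k) := by
  unfold PDenAt
  refine Differentiable.mul (Differentiable.fun_finsetProd fun j _ => by fun_prop)
    (Differentiable.mul (Differentiable.fun_finsetProd fun j _ => ?_) (Differentiable.mul ?_ ?_))
  · simpa using differentiable_theta_exp_neg H.norm_q (a j) 1
  · exact differentiable_qPoch_comp H.norm_q (by fun_prop)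
  · exact differentiable_qPoch_comp H.norm_q (by fun_prop)

lemma PDenAt_ne_zero (hgen : ∀ j k : Fin (2 * N), j ≠ k → ∀ n : ℤ, a j ≠ a k * q ^ n)
    (k : Fin (2 * N)) : PDenAt N q a s k (log (a k)) ≠ 0 := by
  have ha := H.a_ne_zero k
  refine mul_ne_zero (Finset.prod_ne_zero_iff.2 fun j _ => exp_ne_zero _)
    (mul_ne_zero (Finset.prod_ne_zero_iff.2 fun j hj => ?_) (mul_ne_zero ?_ ?_))
  · refine theta_mul_exp_neg_ne_zero H.q_ne_zero H.norm_q (H.a_ne_zero j) fun n => ?_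
    rw [exp_log ha]
    exact hgen k j (Finset.ne_of_mem_erase hj).symm n
  · rw [exp_neg, exp_log ha, mul_inv_cancel₀ ha, one_mul]
    exact qPoch_ne_zero_of_norm_lt H.norm_q H.norm_q
  · rw [exp_log ha, inv_mul_cancel_right₀ ha]
    exact qPoch_ne_zero_of_norm_lt H.norm_q H.norm_q

lemma differentiableAt_PReg {k : Fin (2 * N)} {w : ℂ} (hw : PDenAt N q a s k w ≠ 0) :
    DifferentiableAt ℂ (PReg N q a s k) w := by
  have hp := norm_cpow_half_lt_one H.N_pos H.q_ne_zero H.norm_q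
  unfold PReg
  refine DifferentiableAt.div (DifferentiableAt.mul (by fun_prop) ?_)
    (H.differentiable_PDenAt k w) hw
  simpa using differentiable_theta_exp_neg hp 1 N w

lemma tendsto_sub_mul_PLog (hgen : ∀ j k : Fin (2 * N), j ≠ k → ∀ n : ℤ, a j ≠ a k * q ^ n)
    (k : Fin (2 * N)) : Tendsto (fun w => (w - log (a k)) * PLog N q a s w) (𝓝[≠] (log (a k)))
      (𝓝 (PReg N q a s k (log (a k)))) := by
  have h1 := (H.differentiableAt_PReg (H.PDenAt_ne_zero (s := s) hgen k)).continuousAt.tendsto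
  have h2 := (h1.mono_left nhdsWithin_le_nhds).mul
    (tendsto_sub_mul_exp_div (exp_log (H.a_ne_zero k)))
  rw [mul_one] at h2
  refine h2.congr fun w => ?_
  rw [H.PLog_eq_PReg_mul k]; ring

lemma residue_PLog (hgen : ∀ j k : Fin (2 * N), j ≠ k → ∀ n : ℤ, a j ≠ a k * q ^ n)
    (k : Fin (2 * N)) : residue (PLog N q a s) (log (a k)) = PReg N q a s k (log (a k)) := by
  refine residue_eq_of_tendsto ?_ (H.tendsto_sub_mul_PLog hgen k)
  have h1 : ∀ᶠ w in 𝓝[≠] (log (a k)), PDenAt N q a s k w ≠ 0 :=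
    eventually_ne_zero_of_differentiable (H.differentiable_PDenAt k) (H.PDenAt_ne_zero hgen k) _
  have h2 : ∀ᶠ w in 𝓝[≠] (log (a k)), exp w ≠ a k :=
    (Complex.hasDerivAt_exp _).eventually_ne (exp_ne_zero _)
  filter_upwards [h1, h2] with w hw hw'
  rw [show PLog N q a s = _ from funext (H.PLog_eq_PReg_mul k)]
  exact (H.differentiableAt_PReg hw).mul (Complex.differentiableAt_exp.div
    (Complex.differentiableAt_exp.sub_const _) (sub_ne_zero.2 hw'))

/-- The factor `θ(a_k²)` in the numerator of `h` cancels the `j = k` term of its denominator,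
leaving exactly the product over `j ≠ k`. -/
lemma R_eq (hgen2 : ∀ (j k : Fin (2 * N)) (n : ℤ), a j * a k ≠ q ^ n) (k : Fin (2 * N)) :
    R N q a k = PReg N q a s k (log (a k)) * hLog N q a s (log (a k)) := by
  have ha := H.a_ne_zero k
  have hth : ∀ j, theta (a j * a k) q ≠ 0 := fun j h => by
    obtain ⟨n, hn⟩ := (theta_eq_zero_iff H.q_ne_zero H.norm_q
      (mul_ne_zero (H.a_ne_zero j) ha)).1 h
    exact hgen2 j k n hn
  have hN : exp (-(N * log (a k))) = (a k ^ N)⁻¹ := by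
    rw [exp_neg, exp_nat_mul, exp_log ha]
  -- The `2N` exponents `1/2` sum to `N`, and the `s_j` cancel against the exponent in `h`.
  have hpow : a k ^ ((N : ℂ) / 2 - 1) * ∏ j, exp ((1 / 2 - s j) * log (a k)) =
      exp ((N : ℂ) / 2 * log (a k)) * exp (((N : ℂ) - 1 - ∑ j, s j) * log (a k)) := by
    rw [← exp_sum, cpow_def_of_ne_zero ha, ← exp_add, ← exp_add, ← Finset.sum_mul,
      Finset.sum_sub_distrib, Finset.sum_const, Finset.card_univ, Fintype.card_fin]
    congr 1
    simp only [nsmul_eq_mul]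
    push_cast; ring
  have hprod : ∏ j, exp ((1 / 2 - s j) * log (a k)) ≠ 0 :=
    Finset.prod_ne_zero_iff.2 fun j _ => exp_ne_zero _
  rw [R, PReg, PDenAt, hLog, hN, exp_neg, exp_log ha,
    ← Finset.mul_prod_erase _ (fun j => theta (a j * a k) q) (Finset.mem_univ k),
    Finset.prod_mul_distrib, mul_inv_cancel₀ ha, one_mul, inv_mul_cancel_right₀ ha, sq (a k)]
  simp only [div_eq_mul_inv (a _) (a k)]
  have h1 := hth k
  rw [div_mul_div_comm]
  generalize ∏ j, exp ((1 / 2 - s j) * log (a k)) = X at *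
  generalize theta (a k * a k) q = Y at *
  generalize ∏ j ∈ Finset.univ.erase k, theta (a j * a k) q = Z at *
  generalize ∏ j ∈ Finset.univ.erase k, theta (a j * (a k)⁻¹) q = W at *
  generalize theta (a k ^ N)⁻¹ (q ^ ((N : ℂ) / 2)) = V at *
  generalize qPoch q q = U at *
  rw [show ∀ A B : ℂ, A * V * (B * Y) = A * B * V * Y from fun A B => by ring, ← hpow,
    show a k ^ ((N : ℂ) / 2 - 1) * X * V * Y = (X * Y) * (a k ^ ((N : ℂ) / 2 - 1) * V) by ring,
    show X * (W * (U * U)) * (Y * Z) = (X * Y) * (U ^ 2 * (Z * W)) by ring,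
    mul_div_mul_left _ _ (mul_ne_zero hprod h1)]

lemma hLog_ne_zero (hgen2 : ∀ (j k : Fin (2 * N)) (n : ℤ), a j * a k ≠ q ^ n) (k : Fin (2 * N)) :
    hLog N q a s (log (a k)) ≠ 0 := by
  have ha := H.a_ne_zero k
  have hth : ∀ j, theta (a j * a k) q ≠ 0 := fun j h => by
    obtain ⟨n, hn⟩ := (theta_eq_zero_iff H.q_ne_zero H.norm_q
      (mul_ne_zero (H.a_ne_zero j) ha)).1 h
    exact hgen2 j k n hn
  rw [hLog, exp_log ha, sq]
  exact div_ne_zero (mul_ne_zero (exp_ne_zero _) (hth k))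
    (Finset.prod_ne_zero_iff.2 fun j _ => hth j)

lemma exp_pole (k : Fin (2 * N)) (n : ℕ) : exp (log (a k) + n * log q) = a k * q ^ n := by
  rw [exp_add, exp_nat_mul, exp_log H.q_ne_zero, exp_log (H.a_ne_zero k)]

/-- At these points the numerator `(q z / a_k; q)_∞` contains a vanishing factor, so the bilateral
sum is one-sided. -/
lemma QLog_eq_zero_of_neg (k : Fin (2 * N)) {n : ℤ} (hn : n < 0) :
    QLog N q a s (log (a k) + n * log q) = 0 := by
  have ha := H.a_ne_zero k
  have h1 : exp (log (a k) + n * log q) = a k * q ^ n := by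
    rw [exp_add, exp_int_mul, exp_log H.q_ne_zero, exp_log ha]
  obtain ⟨m, rfl⟩ := Int.eq_negSucc_of_lt_zero hn
  have h2 : qPoch (q * (a k)⁻¹ * exp (log (a k) + (Int.negSucc m : ℤ) * log q)) q = 0 := by
    rw [h1, qPoch_eq_zero_iff H.norm_q]
    refine ⟨m, ?_⟩
    rw [zpow_negSucc, pow_succ]
    have := H.q_ne_zero
    field_simp
  rw [QLog, Finset.prod_eq_zero (Finset.mem_univ k), mul_zero]
  rw [h2, zero_div, mul_zero]

lemma re_log_a_le (k : Fin (2 * N)) : (log (a k)).re ≤ 0 := by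
  rw [log_re]
  exact (Real.log_neg (norm_pos_iff.2 (H.a_ne_zero k)) (H.norm_a k)).le

lemma summable_norm_QLog_nat (hs : ∀ j, q ^ s j = a j) (k : Fin (2 * N)) :
    Summable fun n : ℕ => ‖QLog N q a s (log (a k) + n * log q)‖ := by
  obtain ⟨C, h0, hC⟩ := exists_QLog_bound H.q_ne_zero H.norm_q H.N_pos H.norm_a hs
    (isCompact_singleton (x := log (a k))) (by rintro u rfl; exact H.re_log_a_le k)
  exact Summable.of_nonneg_of_le (fun _ => norm_nonneg _) (fun n => hC _ rfl n)
    ((summable_geometric_of_lt_one (norm_nonneg _) H.ratio_lt_one).mul_left C)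

lemma hasSum_QLog (hs : ∀ j, q ^ s j = a j) (k : Fin (2 * N)) :
    HasSum (fun n : ℤ => QLog N q a s (log (a k) + n * log q))
      (∑' n : ℕ, QLog N q a s (log (a k) + n * log q)) := by
  have h := (H.summable_norm_QLog_nat hs k).of_norm.hasSum
  have hinj : Function.Injective ((↑) : ℕ → ℤ) := Nat.cast_injective
  refine (hinj.hasSum_iff fun n hn => ?_).1 (by simpa [Function.comp_def] using h)
  refine H.QLog_eq_zero_of_neg k (not_le.1 fun h => hn ?_)
  exact ⟨n.toNat, Int.toNat_of_nonneg h⟩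

lemma continuousAt_QLog (k : Fin (2 * N)) (n : ℕ) :
    ContinuousAt (QLog N q a s) (log (a k) + n * log q) := by
  unfold QLog
  refine ContinuousAt.mul (by fun_prop) (tendsto_finsetProd _ fun j _ => ?_)
  refine ContinuousAt.mul (by fun_prop) (ContinuousAt.div ?_ ?_ ?_)
  · exact (differentiable_qPoch_comp H.norm_q (by fun_prop)).continuous.continuousAt
  · exact (differentiable_qPoch_comp H.norm_q (by fun_prop)).continuous.continuousAt
  · apply qPoch_ne_zero_of_norm_lt H.norm_q
    rw [H.exp_pole, norm_mul, norm_mul, norm_pow]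
    exact mul_lt_one_of_nonneg_of_lt_one_left (norm_nonneg _) (H.norm_a j)
      (mul_le_one₀ (H.norm_a k).le (by positivity) (pow_le_one₀ (norm_nonneg _) H.norm_q.le))

/-! ### Residues of Φ at the points `a_k q^n`. -/

/-- Periodicity gives P the same polar coefficient at each shift of `log a_k`, and Q is continuous
there. The factorisation is only needed on a punctured neighbourhood, where its nonvanishing
hypothesis holds. -/
lemma tendsto_sub_mul_PhiLog (hgen : ∀ j k : Fin (2 * N), j ≠ k → ∀ n : ℤ, a j ≠ a k * q ^ n)
    (hs : ∀ j, q ^ s j = a j) (k : Fin (2 * N)) (n : ℕ) :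
    Tendsto (fun w => (w - (log (a k) + n * log q)) * PhiLog N q a w)
      (𝓝[≠] (log (a k) + n * log q))
      (𝓝 (PReg N q a s k (log (a k)) * QLog N q a s (log (a k) + n * log q))) := by
  have h1 : Tendsto (fun w : ℂ => w - n * log q) (𝓝[≠] (log (a k) + n * log q))
      (𝓝[≠] (log (a k))) := by
    refine tendsto_nhdsWithin_iff.2 ⟨?_, ?_⟩
    · have : Tendsto (fun w : ℂ => w - n * log q) (𝓝 (log (a k) + n * log q))
          (𝓝 (log (a k) + n * log q - n * log q)) := Continuous.tendsto (by fun_prop) _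
      rw [add_sub_cancel_right] at this
      exact this.mono_left nhdsWithin_le_nhds
    · filter_upwards [self_mem_nhdsWithin] with w hw h
      exact hw (sub_eq_iff_eq_add.1 h)
  have h2 := ((H.tendsto_sub_mul_PLog (s := s) hgen k).comp h1).mul
    ((H.continuousAt_QLog (s := s) k n).tendsto.mono_left nhdsWithin_le_nhds)
  refine h2.congr' ?_
  have h3 : ∀ᶠ w in 𝓝[≠] (log (a k) + n * log q), ∀ j, qPoch (q * (a j)⁻¹ * exp w) q ≠ 0 :=
    eventually_all.2 fun j => eventually_ne_zero_of_differentiable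
      (f := fun w => qPoch (q * (a j)⁻¹ * exp w) q) (w₀ := log (a j))
      (differentiable_qPoch_comp H.norm_q (by fun_prop)) (by
        rw [exp_log (H.a_ne_zero j), inv_mul_cancel_right₀ (H.a_ne_zero j)]
        exact qPoch_ne_zero_of_norm_lt H.norm_q H.norm_q) _
  filter_upwards [h3] with w hw
  rw [PhiLog_eq_PLog_mul_QLog H.N_pos H.q_ne_zero H.norm_q s w hw, Function.comp_apply,
    ← PLog_add_nat_mul_log H.N_pos H.q_ne_zero H.norm_q hs (w - n * log q) n, sub_add_cancel]
  ring

lemma log_pole_of_odd (hN : Odd N) (k : Fin (2 * N)) (n : ℕ) :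
    log (a k * q ^ n) = log (a k) + n * log q := by
  obtain ⟨⟨hq, hqi⟩, -⟩ := H.odd hN
  have hqr : q = (q.re : ℂ) := by apply Complex.ext <;> simp [hqi]
  have h1 : q ^ n = ((q.re ^ n : ℝ) : ℂ) := by rw [ofReal_pow, ← hqr]
  rw [h1, log_mul_ofReal _ (pow_pos hq n) _ (H.a_ne_zero k), Real.log_pow, H.log_q_eq hN,
    show ‖q‖ = q.re by rw [hqr, norm_real, Real.norm_of_nonneg hq.le, ofReal_re]]
  push_cast; ring

lemma pole_ne_zero (k : Fin (2 * N)) (n : ℕ) : a k * q ^ n ≠ 0 :=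
  mul_ne_zero (H.a_ne_zero k) (pow_ne_zero _ H.q_ne_zero)

/-- Under any local branch of the logarithm `dz/z = du`, so residues transfer between the
coordinates. A general branch is needed because for even `N` a pole may lie on the cut of the
principal one. -/
lemma residue_Phi_of_branch {p u r : ℂ} (hp : p ≠ 0) {ℓ : ℂ → ℂ} (hℓp : ℓ p = u)
    (hℓ : ∀ᶠ z in 𝓝 p, HasDerivAt ℓ z⁻¹ z) (hexp : ∀ᶠ z in 𝓝 p, exp (ℓ z) = z)
    (hPhi : ∀ᶠ z in 𝓝 p, Phi N q a z = PhiLog N q a (ℓ z))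
    (hr : Tendsto (fun w => (w - u) * PhiLog N q a w) (𝓝[≠] u) (𝓝 r)) :
    residue (fun z => Phi N q a z / z) p = r := by
  have hd0 : HasDerivAt ℓ p⁻¹ p := hℓ.self_of_nhds
  have hexpp : exp u = p := hℓp ▸ hexp.self_of_nhds
  have hmap : Tendsto ℓ (𝓝[≠] p) (𝓝[≠] u) := by
    refine tendsto_nhdsWithin_iff.2 ⟨?_, ?_⟩
    · exact hℓp ▸ hd0.continuousAt.tendsto.mono_left nhdsWithin_le_nhds
    · filter_upwards [self_mem_nhdsWithin, nhdsWithin_le_nhds hexp] with z hz hze h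
      exact hz (by rw [Set.mem_singleton_iff, ← hze, h, hexpp])
  refine residue_eq_of_tendsto ?_ ?_
  · have h1 := hmap.eventually ((eventually_PhiDen_ne_zero H.norm_q H.norm_a u).mono fun w hw =>
      differentiableAt_PhiLog H.N_pos H.q_ne_zero H.norm_q hw)
    have hne : ∀ᶠ z in 𝓝 p, z ≠ 0 := isOpen_ne.mem_nhds hp
    filter_upwards [h1, nhdsWithin_le_nhds hℓ, nhdsWithin_le_nhds hPhi.eventually_nhds,
      nhdsWithin_le_nhds hne] with z hz1 hz2 hz3 hz4
    have h2 : DifferentiableAt ℂ (fun z => PhiLog N q a (ℓ z) / z) z :=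
      (DifferentiableAt.comp z hz1 hz2.differentiableAt).div differentiableAt_id hz4
    exact h2.congr_of_eventuallyEq (hz3.mono fun w hw => by simp only [hw])
  · have h1 := (hasDerivAt_iff_tendsto_slope.1 hd0).inv₀ (inv_ne_zero hp)
    have h2 := hr.comp hmap
    have h3 : Tendsto (fun z : ℂ => z⁻¹) (𝓝[≠] p) (𝓝 p⁻¹) :=
      (tendsto_inv₀ hp).mono_left nhdsWithin_le_nhds
    have h4 := (h2.mul h1).mul h3
    rw [inv_inv, mul_assoc, mul_inv_cancel₀ hp, mul_one] at h4
    refine h4.congr' ?_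
    filter_upwards [hmap.eventually self_mem_nhdsWithin, nhdsWithin_le_nhds hPhi,
      self_mem_nhdsWithin] with z hz1 hz2 hz3
    have hz1' : ℓ z - u ≠ 0 := sub_ne_zero.2 hz1
    rw [slope_def_field, inv_div, hℓp, hz2, Function.comp_apply]
    field_simp

lemma residue_Phi (hgen : ∀ j k : Fin (2 * N), j ≠ k → ∀ n : ℤ, a j ≠ a k * q ^ n)
    (hs : ∀ j, q ^ s j = a j) (k : Fin (2 * N)) (n : ℕ) :
    residue (fun z => Phi N q a z / z) (a k * q ^ n) =
      PReg N q a s k (log (a k)) * QLog N q a s (log (a k) + n * log q) := by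
  have hr := H.tendsto_sub_mul_PhiLog hgen hs k n
  have hp := H.pole_ne_zero k n
  have hne : ∀ᶠ z in 𝓝 (a k * q ^ n), z ≠ 0 := isOpen_ne.mem_nhds hp
  rcases Nat.even_or_odd N with hN | hN
  · refine H.residue_Phi_of_branch (u := log (a k) + n * log q) hp
      (ℓ := fun z => log (z / (a k * q ^ n)) + (log (a k) + n * log q)) ?_ ?_ ?_ ?_ hr
    · simp [div_self hp]
    · have hcont : ContinuousAt (fun z => z / (a k * q ^ n)) (a k * q ^ n) := by fun_prop
      have hslit : ∀ᶠ z in 𝓝 (a k * q ^ n), z / (a k * q ^ n) ∈ slitPlane :=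
        hcont.eventually (isOpen_slitPlane.mem_nhds (by simp [div_self hp]))
      filter_upwards [hslit, hne] with z hz hz0
      have := (((hasDerivAt_id z).div_const (a k * q ^ n)).clog hz).add_const
        (log (a k) + n * log q)
      refine this.congr_deriv ?_
      change 1 / (a k * q ^ n) / (z / (a k * q ^ n)) = z⁻¹
      generalize a k * q ^ n = p at *
      field_simp
    · filter_upwards [hne] with z hz
      rw [exp_add, exp_log (div_ne_zero hz hp), H.exp_pole, div_mul_cancel₀ _ hp]
    · filter_upwards [hne] with z hz
      have h1 : exp (log z) = exp (log (z / (a k * q ^ n)) + (log (a k) + n * log q)) := by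
        rw [exp_log hz, exp_add, exp_log (div_ne_zero hz hp), H.exp_pole, div_mul_cancel₀ _ hp]
      obtain ⟨m, hm⟩ := exp_eq_exp_iff_exists_int.1 h1
      rw [Phi, hm, PhiLog_add_int_of_even hN]
  · have hlog := H.log_pole_of_odd hN k n
    have hslit : a k * q ^ n ∈ slitPlane := by
      rw [mem_slitPlane_iff_arg]
      refine ⟨?_, hp⟩
      have h1 := (mem_slitPlane_iff_arg.1 ((H.odd hN).2 k)).1
      rw [← log_im, hlog, H.log_q_eq hN]
      simpa [log_im] using h1
    refine H.residue_Phi_of_branch hp hlog ?_ ?_ (Eventually.of_forall fun z => rfl) hr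
    · filter_upwards [isOpen_slitPlane.mem_nhds hslit] with z hz using hasDerivAt_log hz
    · filter_upwards [hne] with z hz using exp_log hz

/-- For even `N` all logarithms of a pole are equivalent. For odd `N` the pole is off the cut, so
its only logarithm in the strip is the principal one, which is `log a_k + n log q`. -/
lemma tendsto_sub_mul_PhiLog_of_mem_rect
    (hgen : ∀ j k : Fin (2 * N), j ≠ k → ∀ n : ℤ, a j ≠ a k * q ^ n)
    (hs : ∀ j, q ^ s j = a j) (k : Fin (2 * N)) (n : ℕ) {u : ℂ}
    (hu : u.im ∈ Set.Icc (-Real.pi) Real.pi) (hexp : exp u = a k * q ^ n) :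
    Tendsto (fun w => (w - u) * PhiLog N q a w) (𝓝[≠] u)
      (𝓝 (PReg N q a s k (log (a k)) * QLog N q a s (log (a k) + n * log q))) := by
  have hr := H.tendsto_sub_mul_PhiLog hgen hs k n
  rcases Nat.even_or_odd N with hN | hN
  · obtain ⟨m, hm⟩ := exp_eq_exp_iff_exists_int.1 ((H.exp_pole k n).trans hexp.symm)
    have h1 : Tendsto (fun w : ℂ => w + m * (2 * Real.pi * I)) (𝓝[≠] u)
        (𝓝[≠] (u + m * (2 * Real.pi * I))) := by
      refine tendsto_nhdsWithin_iff.2 ⟨?_, ?_⟩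
      · exact (Continuous.tendsto (by fun_prop) _).mono_left nhdsWithin_le_nhds
      · filter_upwards [self_mem_nhdsWithin] with w hw h
        exact hw (add_right_cancel h)
    rw [← hm] at h1
    refine (hr.comp h1).congr fun w => ?_
    rw [Function.comp_apply, PhiLog_add_int_of_even hN, hm]
    ring
  · have him : u.im ≠ -Real.pi := fun h =>
      H.exp_ne_of_im_eq_pi hN (Or.inr h) k n (by exact_mod_cast hexp)
    have : u = log (a k) + n * log q := by
      rw [← H.log_pole_of_odd hN, ← hexp, log_exp (lt_of_le_of_ne hu.1 him.symm) hu.2]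
    rw [this]
    exact hr

/-! ### Summation over all residues. -/

lemma pole_injective (hgen : ∀ j k : Fin (2 * N), j ≠ k → ∀ n : ℤ, a j ≠ a k * q ^ n) :
    Function.Injective fun p : Fin (2 * N) × ℕ => a p.1 * q ^ p.2 := by
  rintro ⟨k, n⟩ ⟨j, m⟩ h
  have hq0 := H.q_ne_zero
  simp only at h
  have hkj : k = j := by
    by_contra hne
    apply hgen k j hne (m - n)
    rw [zpow_sub₀ hq0, zpow_natCast, zpow_natCast, ← mul_div_assoc, ← h]
    field_simp
  subst hkj
  have h1 := congrArg norm (mul_left_cancel₀ (H.a_ne_zero k) h)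
  rw [norm_pow, norm_pow] at h1
  rw [(pow_right_strictAnti₀ (norm_pos_iff.2 hq0) H.norm_q).injective h1]

lemma exists_avoidsPoles : ∃ τ ∈ Set.Icc (Real.log ‖q‖) 0, AvoidsPoles N q a τ := by
  obtain ⟨τ, h1, h2⟩ := ((Set.Icc_infinite H.log_norm_q_neg).sdiff
    (H.finite_poles_inter (Real.log ‖q‖) 0)).nonempty
  exact ⟨τ, h1, by by_contra h; exact h2 ⟨h1, h⟩⟩

lemma finite_poles_gt (t : ℝ) :
    {p : Fin (2 * N) × ℕ | t < Real.log ‖a p.1‖ + p.2 * Real.log ‖q‖}.Finite := by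
  refine ((Set.finite_univ (α := Fin (2 * N))).prod
    (Set.finite_Iic ⌈t / Real.log ‖q‖⌉₊)).subset ?_
  rintro ⟨k, n⟩ h
  refine ⟨Set.mem_univ _, ?_⟩
  have h1 := Real.log_neg (norm_pos_iff.2 (H.a_ne_zero k)) (H.norm_a k)
  have h : t < Real.log ‖a k‖ + n * Real.log ‖q‖ := h
  have h2 : (n : ℝ) < t / Real.log ‖q‖ := by
    rw [lt_div_iff_of_neg H.log_norm_q_neg]; linarith
  have h3 : (n : ℝ) ≤ (⌈t / Real.log ‖q‖⌉₊ : ℝ) := h2.le.trans (Nat.le_ceil _)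
  exact_mod_cast h3

/-- The residue theorem between the unit circle and the circle of radius `e^t`. -/
lemma sum_residues_eq (hgen : ∀ j k : Fin (2 * N), j ≠ k → ∀ n : ℤ, a j ≠ a k * q ^ n)
    (hs : ∀ j, q ^ s j = a j) {t : ℝ} (ht : t < 0) (hgood : AvoidsPoles N q a t) :
    2 * Real.pi * I * ∑ p ∈ (H.finite_poles_gt t).toFinset,
        PReg N q a s p.1 (log (a p.1)) * QLog N q a s (log (a p.1) + p.2 * log q) =
      I * verticalIntegral N q a 0 - I * verticalIntegral N q a t
        + ∫ x in (0 : ℝ)..(-t), edge N q a x := by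
  have hnorm : ∀ p : Fin (2 * N) × ℕ, ‖a p.1 * q ^ p.2‖ =
      Real.exp (Real.log ‖a p.1‖ + p.2 * Real.log ‖q‖) := fun p => by
    rw [Real.exp_add, Real.exp_nat_mul, Real.exp_log (norm_pos_iff.2 (H.a_ne_zero _)),
      Real.exp_log (norm_pos_iff.2 H.q_ne_zero), norm_mul, norm_pow]
  have hrect := integral_rect_eq_sum_residues (H.finite_poles_gt t).toFinset
    (fun p : Fin (2 * N) × ℕ => a p.1 * q ^ p.2)
    (fun p => PReg N q a s p.1 (log (a p.1)) * QLog N q a s (log (a p.1) + p.2 * log q))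
    (H.pole_injective hgen).injOn (PhiLog N q a) ht
    (fun p hp => by
      rw [hnorm, Real.exp_lt_exp, Real.exp_lt_exp]
      refine ⟨by simpa using hp, ?_⟩
      have h1 := Real.log_neg (norm_pos_iff.2 (H.a_ne_zero p.1)) (H.norm_a p.1)
      have h2 := mul_nonpos_of_nonneg_of_nonpos (Nat.cast_nonneg (α := ℝ) p.2) H.log_norm_q_neg.le
      linarith)
    (fun u hu _ hne => H.differentiableAt_PhiLog_of_re hu.2 fun j n hn => by
      have h1 := norm_exp_eq_iff (n := n) (H.a_ne_zero j) H.q_ne_zero (by exact_mod_cast hn)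
      refine hne (j, n) ?_ hn
      simp only [Set.Finite.mem_toFinset, Set.mem_ofPred_eq]
      rw [Int.cast_natCast] at h1
      rw [← h1]
      -- A pole on the left side itself is excluded because the circle avoids the orbits.
      refine lt_of_le_of_ne hu.1 fun h => hgood j n ?_
      rw [h, h1, Int.cast_natCast])
    (fun u => (eventually_PhiDen_ne_zero H.norm_q H.norm_a u).mono fun w hw =>
      differentiableAt_PhiLog H.N_pos H.q_ne_zero H.norm_q hw)
    (fun u _ hu p _ hp => H.tendsto_sub_mul_PhiLog_of_mem_rect hgen hs p.1 p.2 hu hp)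
  -- Oddness of the jump turns the inner part of the cut into the outer one, which tends to the tail
  -- of the contour.
  have hedge : ∫ x in t..0, edge N q a x = -∫ x in (0 : ℝ)..(-t), edge N q a x := by
    have := intervalIntegral.integral_comp_neg (a := t) (b := 0) (edge N q a)
    rw [neg_zero] at this
    simp only [edge_neg] at this
    rw [intervalIntegral.integral_neg] at this
    exact (neg_eq_iff_eq_neg.1 this)
  rw [← hrect, verticalIntegral, verticalIntegral]
  unfold edge at hedge ⊢
  rw [hedge]
  ring

lemma summable_residues (hs : ∀ j, q ^ s j = a j) :
    Summable fun p : Fin (2 * N) × ℕ =>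
      PReg N q a s p.1 (log (a p.1)) * QLog N q a s (log (a p.1) + p.2 * log q) := by
  apply Summable.of_norm
  rw [summable_prod_of_nonneg fun _ => norm_nonneg _]
  refine ⟨fun k => ?_, Summable.of_finite⟩
  simp only [norm_mul]
  exact (H.summable_norm_QLog_nat hs k).mul_left _

omit H in
lemma IN_eq : 2 * Real.pi * I * IN N q a =
    I * verticalIntegral N q a 0 + ∫ x in Set.Ioi (1 : ℝ), tailIntegrand N q a x := by
  have h := circleIntegral_Phi (N := N) (q := q) (a := a) 0
  rw [Real.exp_zero] at h
  rw [IN, h, mul_inv_cancel_left₀ two_pi_I_ne_zero]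

/-- Absolute summability is known beforehand from the decay of Q, so the sum can be identified along
one exhausting sequence of finite sets: the poles outside circles shrinking by `|q|`. -/
lemma hasSum_residues (hgen : ∀ j k : Fin (2 * N), j ≠ k → ∀ n : ℤ, a j ≠ a k * q ^ n)
    (hs : ∀ j, q ^ s j = a j) :
    HasSum (fun p : Fin (2 * N) × ℕ =>
      PReg N q a s p.1 (log (a p.1)) * QLog N q a s (log (a p.1) + p.2 * log q)) (IN N q a) := by
  obtain ⟨τ, hτ, hgood⟩ := H.exists_avoidsPoles
  have hl := H.log_norm_q_neg
  -- The shift by `m + 1` keeps `t m` strictly negative even when `τ = 0`.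
  set t : ℕ → ℝ := fun m => τ + (m + 1 : ℕ) * Real.log ‖q‖ with ht
  have htneg : ∀ m, t m < 0 := fun m => by
    have : ((m + 1 : ℕ) : ℝ) * Real.log ‖q‖ < 0 := mul_neg_of_pos_of_neg (by positivity) hl
    simp only [ht]; linarith [hτ.2]
  have htgood : ∀ m, AvoidsPoles N q a (t m) := fun m => AvoidsPoles.add_nat hgood _
  have htlim : Tendsto t atTop atBot := by
    refine tendsto_atBot_add_const_left _ _ ?_
    exact ((tendsto_natCast_atTop_atTop (R := ℝ)).comp (tendsto_add_atTop_nat 1)).atTop_mul_const_of_neg hl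
  have hsum := (H.summable_residues hs).hasSum
  have hT : Tendsto (fun m => (H.finite_poles_gt (t m)).toFinset) atTop atTop := by
    refine tendsto_atTop_finset_of_monotone ?_ ?_
    · intro m m' hm p hp
      simp only [Set.Finite.mem_toFinset, Set.mem_ofPred_eq] at hp ⊢
      refine lt_of_le_of_lt ?_ hp
      have : ((m + 1 : ℕ) : ℝ) ≤ ((m' + 1 : ℕ) : ℝ) := by exact_mod_cast Nat.succ_le_succ hm
      simp only [ht]
      nlinarith
    · intro p
      obtain ⟨m, hm⟩ := (htlim.eventually (eventually_lt_atBot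
        (Real.log ‖a p.1‖ + p.2 * Real.log ‖q‖))).exists
      exact ⟨m, by simpa using hm⟩
  have h1 := (hsum.comp hT).const_mul (2 * Real.pi * I)
  have hV : Tendsto (fun m => verticalIntegral N q a (t m)) atTop (𝓝 0) := by
    obtain ⟨C, h0, hC⟩ := H.exists_verticalIntegral_decay
    have h2 : Tendsto (fun m => C * Real.exp (decayRate N q a * t m)) atTop (𝓝 0) := by
      have := (Real.tendsto_exp_atBot.comp (htlim.const_mul_atBot H.decayRate_pos)).const_mul C
      simpa using this
    exact squeeze_zero_norm (fun m => hC _ (htneg m).le (htgood m)) h2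
  have h2 : Tendsto (fun m => I * verticalIntegral N q a 0 - I * verticalIntegral N q a (t m)
      + ∫ x in (0 : ℝ)..(-t m), edge N q a x) atTop (𝓝 (2 * Real.pi * I * IN N q a)) := by
    rw [IN_eq]
    have := (tendsto_const_nhds (x := I * verticalIntegral N q a 0)).sub (hV.const_mul I)
    rw [mul_zero, sub_zero] at this
    exact this.add (H.tendsto_integral_edge.comp (tendsto_neg_atBot_atTop.comp htlim))
  have h3 := tendsto_nhds_unique h1 (h2.congr fun m =>
    (H.sum_residues_eq hgen hs (htneg m) (htgood m)).symm)
  rw [← mul_left_cancel₀ two_pi_I_ne_zero h3]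
  exact hsum

lemma exists_exponents : ∃ s : Fin (2 * N) → ℂ, ∀ j, q ^ s j = a j := by
  have hlog : log q ≠ 0 := fun h => by
    have h1 := H.log_norm_q_neg
    rw [← log_re, h] at h1
    simp at h1
  exact ⟨fun j => log (a j) / log q, fun j => by
    rw [cpow_def_of_ne_zero H.q_ne_zero, mul_div_cancel₀ _ hlog, exp_log (H.a_ne_zero j)]⟩

lemma IN_eq_sum (hgen : ∀ j k : Fin (2 * N), j ≠ k → ∀ n : ℤ, a j ≠ a k * q ^ n)
    (hgen2 : ∀ (j k : Fin (2 * N)) (n : ℤ), a j * a k ≠ q ^ n) (hs : ∀ j, q ^ s j = a j) :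
    IN N q a = ∑ k, R N q a k * regJ N q a s (a k) := by
  have h1 := (H.hasSum_residues hgen hs).prod_fiberwise fun k =>
    (H.summable_norm_QLog_nat hs k).of_norm.hasSum.mul_left (PReg N q a s k (log (a k)))
  rw [← (hasSum_fintype _).unique h1]
  refine Finset.sum_congr rfl fun k _ => ?_
  rw [R_eq (s := s) H hgen2, regJ, JLog, (H.hasSum_QLog hs k).tsum_eq, mul_assoc,
    mul_div_cancel₀ _ (H.hLog_ne_zero hgen2 k)]

end Admissible
end SemiClassical

theorem mainTheorem5 (N : ℕ) (hN : 2 ≤ N) (q : ℂ) (hq0 : q ≠ 0) (hq1 : ‖q‖ < 1)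
    (a : Fin (2 * N) → ℂ) (ha1 : ∀ j, ‖a j‖ < 1)
    (hodd : Odd N → (0 < q.re ∧ q.im = 0) ∧ ∀ j, a j ∈ Complex.slitPlane)
    (hcond : ‖q ^ (N - 1)‖ < ‖∏ j, a j‖) :
    -- the integral over a small circle, not passing through a pole, tends to zero
    Tendsto (SemiClassical.IEps N q a)
      (𝓝[>] (0 : ℝ) ⊓ 𝓟 {ε : ℝ | ∀ (k : Fin (2 * N)) (ν : ℕ), ε ≠ ‖a k * q ^ ν‖}) (𝓝 0) ∧
    -- the integrals that define `I_N` converge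
    CircleIntegrable (fun z => SemiClassical.Phi N q a z / z) 0 1 ∧
    IntegrableOn (SemiClassical.tailIntegrand N q a) (Set.Ioi 1) ∧
    ((∀ j k : Fin (2 * N), j ≠ k → ∀ n : ℤ, a j ≠ a k * q ^ n) →
      -- `I_N` is the sum of the residues
      HasSum (fun p : Fin (2 * N) × ℕ =>
          SemiClassical.residue (fun z => SemiClassical.Phi N q a z / z) (a p.1 * q ^ p.2))
        (SemiClassical.IN N q a) ∧
      ((∀ (j k : Fin (2 * N)) (n : ℤ), a j * a k ≠ q ^ n) →
        ∀ s : Fin (2 * N) → ℂ, (∀ j, q ^ s j = a j) →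
          -- the Jackson integrals converge, `R_k` is the residue of `P(z) dz / z` at `a_k`
          -- (with `dz / z = du` for `z = e^u`) times `h(a_k)`, and `I_N = ∑ R_k 𝒥_N(a_k)`
          (∀ k, Summable (fun ν : ℤ =>
            SemiClassical.QLog N q a s (Complex.log (a k) + ν * Complex.log q))) ∧
          (∀ k, SemiClassical.R N q a k =
            SemiClassical.residue (SemiClassical.PLog N q a s) (Complex.log (a k))
              * SemiClassical.hLog N q a s (Complex.log (a k))) ∧
          SemiClassical.IN N q a =
            ∑ k, SemiClassical.R N q a k * SemiClassical.regJ N q a s (a k))) := by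
  have H : SemiClassical.Admissible N q a := ⟨hN, hq0, hq1, ha1, hodd, hcond⟩
  refine ⟨H.tendsto_IEps, H.circleIntegrable_Phi, H.integrableOn_tailIntegrand, fun hgen => ⟨?_, ?_⟩⟩
  -- The residue expansion does not involve the exponents, so any choice of them serves.
  · obtain ⟨s, hs⟩ := H.exists_exponents
    simpa only [H.residue_Phi hgen hs] using H.hasSum_residues hgen hs
  · intro hgen2 s hs
    refine ⟨fun k => (H.hasSum_QLog hs k).summable, fun k => ?_, H.IN_eq_sum hgen hgen2 hs⟩
    rw [H.residue_PLog hgen, H.R_eq (s := s) hgen2]
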